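/- Let $d\ge 1$, $r\in\mathbb R$, $\xi>0$, $\ell_0\in\mathbb N$ and $\kappa>0$. \textbf{Setting.} Let $\Lambda\subset\mathbb Z^d$ be a finite set of $n$ sites, with the Manhattan distance, each carrying a spin $1/2$. Let $H=\sum_{i\in\Lambda}H_i$ with self-adjoint $H_i$, $\|H_i\|\le 1$ (operator norm), where $H_i$ acts only on spins at distance at most $\ell_0$ from $i$. Let $E_m$, $|E_m\rangle$ ($0\le m<2^n$) be the eigenvalues and an orthonormal eigenbasis of $H$. For $\beta\ge 0$, $\Delta>0$ and $E\in\mathbb R$ put $$\rho_\beta=\frac{e^{-\beta H}}{\operatorname{tr}e^{-\beta H}},\qquad \mathcal N_{E,\Delta}=\#\{m:E_m\in(E-\Delta,E]\},\qquad \rho_{E,\Delta}=\frac1{\mathcal N_{E,\Delta}}\sum_{E_m\in(E-\Delta,E]}|E_m\rangle\langle E_m| .$$ Assume that $E$ maximizes $E'\mapsto e^{-\beta E'}\mathcal N_{E',\Delta}$ over $\mathbb R$, and that $\rho_\beta$ is $(r,\xi)$-clustering: for all nonempty $X,Y\subseteq\Lambda$ with $\operatorname{dist}(X,Y)\ge r$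 and all operators $A$, $B$ supported on $X$ and $Y$ respectively, $$|\operatorname{tr}(\rho_\beta AB)-\operatorname{tr}(\rho_\beta A)\operatorname{tr}(\rho_\beta B)|\le\|A\|\,\|B\|\,e^{-\operatorname{dist}(X,Y)/\xi}.$$ Assume further that $$1+\log\min\{n,\,1+\beta\Delta\}\le\kappa\,\log(\sqrt n/\Delta)\qquad(\ast)$$ (for $\Delta\le1$ and $n\ge2$ this holds with $\kappa=5$, whatever $\beta$ is). Let $\ell\ge1$ and let $\Lambda$ be partitioned into $n_\ell=n/\ell^d$ hypercubes $B_1,\dots,B_{n_\ell}$ with $\ell^d$ sites each; $(\rho)_{B}$ denotes the reduced density matrix of $\rho$ on $B$ and $\|\cdot\|_1$ the trace norm. Put $$D=\frac1{n_\ell}\sum_{s=1}^{n_\ell}\bigl\|(\rho_{E,\Delta})_{B_s}-(\rho_\beta)_{B_s}\bigr\|_1 .$$ \textbf{Claim.} (1) There are constants $c_1',c_2'>0$ that depend only on $d,r,\xi,\ell_0,\kappa$ such that in every such setting $$D\le n_\ell^{-1/2}\max\Bigl(c_1'\,\ell^{-d/2}\log^{\frac{d+1}2}\bigl(\sqrt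 n/\Delta\bigr),\;c_2'\sqrt{\log\bigl(\sqrt n/\Delta\bigr)}\Bigr).$$ (2) Consequently the two ensembles agree on blocks as large as $\ell^d=O(n^{1-\epsilon})$ when $\Delta$ is at least an inverse polynomial in $n$: for all $\epsilon,K,a>0$ and $p\in\mathbb R$ there is a constant $c$, depending only on these and on $d,r,\xi,\ell_0,\kappa$, such that in every such setting with $n\ge2$, $\Delta\ge a\,n^{-p}$ and $\ell^d\le K n^{1-\epsilon}$, $$D\le c\,n^{-\epsilon/2}(\log n)^{\frac{d+1}2},$$ and $D\to0$ as $n\to\infty$, uniformly over all such settings. -/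

import Mathlib

open scoped Matrix

noncomputable section

namespace SpinLattice

/-! ### Finite spin-1/2 systems -/

/-- Basis configurations of spins 1/2 sitting on the sites of `V`. The Hilbert space is
`ℂ ^ Config V`, the `|V|`-fold tensor power of `ℂ²`. -/
abbrev Config (V : Type) : Type := V → Fin 2

/-- Operators on the Hilbert space of the spins in `V`, as matrices in the product basis. -/
abbrev Op (V : Type) : Type := Matrix (Config V) (Config V) ℂ

section Finite

variable {V : Type} [Fintype V] [DecidableEq V]

/-- The operator norm with respect to the Euclidean norm of the Hilbert space. -/
def opNorm {ι : Type} [Fintype ι] [DecidableEq ι] (A : Matrix ι ι ℂ) : ℝ :=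
  ‖Matrix.toEuclideanCLM (𝕜 := ℂ) A‖

/-- The trace norm: the sum of the singular values. -/
def traceNorm {ι : Type} [Fintype ι] [DecidableEq ι] (A : Matrix ι ι ℂ) : ℝ :=
  ∑ i, √((Matrix.isHermitian_conjTranspose_mul_self A).eigenvalues i)

/-- The operator `a ⊗ 1` on the spins in `V`, for an operator `a` on the spins in `X ⊆ V`. -/
def embed (X : Finset V) (a : Op X) : Op V := fun σ τ =>
  if ∀ i, i ∉ X → σ i = τ i then a (fun i => σ i) (fun i => τ i) else 0

/-- `A` is supported on `X`: it acts trivially on the spins outside `X`. -/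
def SupportedOn (X : Finset V) (A : Op V) : Prop := ∃ a : Op X, A = embed X a

/-- The configuration equal to `σ` on `B` and to `η` outside `B`. -/
def glue (B : Finset V) (σ : Config B) (η : Config {i : V // i ∉ B}) : Config V := fun i =>
  if h : i ∈ B then σ ⟨i, h⟩ else η ⟨i, h⟩

/-- The reduced density matrix on `B`: the partial trace over the spins outside `B`. -/
def reduced (B : Finset V) (ρ : Op V) : Op B := fun σ τ =>
  ∑ η : Config {i : V // i ∉ B}, ρ (glue B σ η) (glue B τ η)

/-- The canonical density matrix `e^{-βH} / tr e^{-βH}`. -/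
def canonical (H : Op V) (β : ℝ) : Op V :=
  (NormedSpace.exp (-(β : ℂ) • H)).trace⁻¹ • NormedSpace.exp (-(β : ℂ) • H)

/-- The labels `m` of the eigenstates whose energy lies in the shell `(E - Δ, E]`. -/
def shell {H : Op V} (hH : H.IsHermitian) (E Δ : ℝ) : Finset (Config V) :=
  Finset.univ.filter fun m => hH.eigenvalues m ∈ Set.Ioc (E - Δ) E

/-- The number of eigenstates in the energy shell `(E - Δ, E]`, with multiplicity. -/
def shellCount {H : Op V} (hH : H.IsHermitian) (E Δ : ℝ) : ℕ := (shell hH E Δ).card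

/-- The microcanonical density matrix: the equal mixture of the eigenstates in the shell
`(E - Δ, E]`. -/
def microcanonical {H : Op V} (hH : H.IsHermitian) (E Δ : ℝ) : Op V :=
  (shellCount hH E Δ : ℂ)⁻¹ • ∑ m ∈ shell hH E Δ,
    Matrix.vecMulVec (fun σ => hH.eigenvectorBasis m σ) (fun σ => star (hH.eigenvectorBasis m σ))

/-- The energy `E` corresponds to the inverse temperature `β` for shells of width `Δ`:
it maximizes `E' ↦ e^{-βE'} 𝒩_{E',Δ}` over all real energies. -/
def IsShellEnergy {H : Op V} (hH : H.IsHermitian) (β Δ E : ℝ) : Prop :=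
  ∀ E' : ℝ, Real.exp (-β * E') * shellCount hH E' Δ ≤ Real.exp (-β * E) * shellCount hH E Δ

end Finite

/-! ### Geometry of the hypercubic lattice `ℤ^d` -/

/-- The Manhattan distance on `ℤ^d`. -/
def manhattan {d : ℕ} (x y : Fin d → ℤ) : ℕ := ∑ k, (x k - y k).natAbs

/-- The hypercube of side `ℓ` (with `ℓ ^ d` sites) with lowest corner `c`. -/
def cube {d : ℕ} (ℓ : ℕ) (c : Fin d → ℤ) : Finset (Fin d → ℤ) :=
  Fintype.piFinset fun k => Finset.Ico (c k) (c k + ℓ)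

/-- The distance `min_{i ∈ X, j ∈ Y} dist(i, j)` of two nonempty sets of sites. -/
def setDist {d : ℕ} {Λ : Finset (Fin d → ℤ)} (X Y : Finset Λ) : ℕ :=
  sInf {m | ∃ i ∈ X, ∃ j ∈ Y, m = manhattan i.1 j.1}

/-- The sites of `Λ` at distance at most `R` from `i`. -/
def ballAt {d : ℕ} {Λ : Finset (Fin d → ℤ)} (R : ℕ) (i : Λ) : Finset Λ :=
  Finset.univ.filter fun j => manhattan i.1 j.1 ≤ R

/-- The sites of `Λ` in the hypercube of side `ℓ` with lowest corner `c`. -/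
def block {d : ℕ} (Λ : Finset (Fin d → ℤ)) (ℓ : ℕ) (c : Fin d → ℤ) : Finset Λ :=
  Finset.univ.filter fun i => i.1 ∈ cube ℓ c

/-- The hypercubes of side `ℓ` with lowest corners in `C` partition the lattice `Λ`. -/
def IsCubePartition {d : ℕ} (Λ : Finset (Fin d → ℤ)) (ℓ : ℕ) (C : Finset (Fin d → ℤ)) : Prop :=
  (C : Set (Fin d → ℤ)).PairwiseDisjoint (cube ℓ) ∧ C.biUnion (cube ℓ) = Λ

/-- The density matrix `ρ` satisfies `(r, ξ)`-clustering. -/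
def Clustering {d : ℕ} {Λ : Finset (Fin d → ℤ)} (r ξ : ℝ) (ρ : Op Λ) : Prop :=
  ∀ X Y : Finset Λ, X.Nonempty → Y.Nonempty → r ≤ setDist X Y →
    ∀ A B : Op Λ, SupportedOn X A → SupportedOn Y B →
      ‖(ρ * A * B).trace - (ρ * A).trace * (ρ * B).trace‖ ≤
        opNorm A * opNorm B * Real.exp (-(setDist X Y : ℝ) / ξ)

/-- A spin-1/2 system on a finite piece `Λ` of `ℤ^d` whose Hamiltonian `∑_{i ∈ Λ} H_i` has
self-adjoint local terms with `‖H_i‖ ≤ 1`, the term `H_i` acting on spins at distance at most `ℓ₀`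
from `i`. -/
structure LocalSystem (d ℓ₀ : ℕ) where
  Λ : Finset (Fin d → ℤ)
  term : Λ → Op Λ
  isHermitian_term : ∀ i, (term i).IsHermitian
  norm_term_le : ∀ i, opNorm (term i) ≤ 1
  supported_term : ∀ i, SupportedOn (ballAt ℓ₀ i) (term i)

namespace LocalSystem

variable {d ℓ₀ : ℕ} (S : LocalSystem d ℓ₀)

/-- The number of sites. -/
def n : ℕ := S.Λ.card

/-- The Hamiltonian. -/
def ham : Op S.Λ := ∑ i, S.term i

theorem isHermitian_ham : S.ham.IsHermitian := by
  unfold ham Matrix.IsHermitian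
  rw [Matrix.conjTranspose_sum]
  exact Finset.sum_congr rfl fun i _ => S.isHermitian_term i

/-- The average over the blocks (the cubes of side `ℓ` with lowest corners in `C`) of the trace
distance `‖(ρ_{E,Δ})_B - (ρ_β)_B‖₁` of the reduced density matrices. -/
def avgBlockDist (β E Δ : ℝ) (ℓ : ℕ) (C : Finset (Fin d → ℤ)) : ℝ :=
  (C.card : ℝ)⁻¹ * ∑ c ∈ C,
    traceNorm (reduced (block S.Λ ℓ c) (microcanonical S.isHermitian_ham E Δ) -
      reduced (block S.Λ ℓ c) (canonical S.ham β))

/-- The setting: an inverse temperature `β ≥ 0` at which the canonical state clusters, a shell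
width `Δ > 0` and the corresponding energy `E`, a partition of the lattice into cubes of side `ℓ`,
and the requirement that `log (√n / Δ)` is not too small, quantified by `κ`; for `Δ ≤ 1` and
`2 ≤ n` the last condition always holds with `κ = 5`. -/
structure Admissible (r ξ κ β E Δ : ℝ) (ℓ : ℕ) (C : Finset (Fin d → ℤ)) : Prop where
  beta_nonneg : 0 ≤ β
  clustering : Clustering r ξ (canonical S.ham β)
  width_pos : 0 < Δ
  energy : IsShellEnergy S.isHermitian_ham β Δ E
  width_le : 1 + Real.log (min (S.n : ℝ) (1 + β * Δ)) ≤ κ * Real.log (√(S.n : ℝ) / Δ)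
  side_pos : 1 ≤ ℓ
  partition : IsCubePartition S.Λ ℓ C

end LocalSystem

end SpinLattice

end

noncomputable section

namespace SpinLattice

section LinearAlgebra

variable {ι : Type} [Fintype ι] [DecidableEq ι]

/-! ### The operator norm -/

/-! The proof compares high moments of one observable in the two ensembles. On each block take the
sign `a` of the difference of the reduced states, centre it in the canonical state, and let `Y` be
the sum over the `N` blocks. The microcanonical expectation of `Y` is then exactly the sum `T` of
the trace norms. Iterated Cauchy-Schwarz gives `T ^ (2k) ≤ tr(ρ_{E,Δ} Y ^ (2k))` whenever `k` is a
power of two.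

Both states are diagonal in the eigenbasis of `H`, and every level in the shell satisfies `E_m ≤ E`.
Hence `ρ_{E,Δ} ≤ M ρ_β` as soon as `Z ≤ M e^{-βE} 𝒩_{E,Δ}` (`shellWeight_le`), at the cost of a
single factor `M`, however large the moment. To bound `M`, clustering makes the energy variance
`O(n)`, so half of the Gibbs weight lies in a window of width `O(√n)`. Cut the window into bins of
width at most `Δ` and `1/β`; by maximality of `E` each bin weighs at most `e · e^{-βE} 𝒩_{E,Δ}`. A
separate count above the ground energy replaces the factor `1 + βΔ` by `O(n)` when `βΔ` is large.
The hypothesis on `κ` then yields `log M = O(L)` with `L = log(√n/Δ)` (`exists_partitionFn_le`).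

The canonical moment expands into tuples of `2k` blocks (`norm_moment_le`). Let `D` be the least
scale at which every block of the tuple has another one within distance `D`. Some block is then at
distance at least `D` from all others, so clustering gives a factor `e^{-D/ξ}`. The linkage graph
has no isolated vertex, hence a dominating set of size `k`: only `k` blocks are free, each other one
lying near one of them. Summing over `D` gives, up to a constant prefactor, `(const · N k)^k ·
max(1, const · k/ℓ)^{dk}`.

With `k` of order `L`, the factor `M` has a bounded `k`-th root, so `T² ≤ const · N L max(1, const ·
L/ℓ)^d`. The two values of this maximum are the two terms of the first claim. The second claim
follows from `N = n/ℓ^d` and `L = O(log n)`. -/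

theorem opNorm_nonneg (A : Matrix ι ι ℂ) : 0 ≤ opNorm A := norm_nonneg _

theorem opNorm_mul_le (A B : Matrix ι ι ℂ) : opNorm (A * B) ≤ opNorm A * opNorm B := by
  unfold opNorm
  rw [map_mul]
  exact norm_mul_le _ _

theorem opNorm_sub_le (A B : Matrix ι ι ℂ) : opNorm (A - B) ≤ opNorm A + opNorm B := by
  unfold opNorm
  rw [map_sub]
  exact norm_sub_le _ _

theorem opNorm_one_le : opNorm (1 : Matrix ι ι ℂ) ≤ 1 := by
  unfold opNorm
  rw [map_one]
  exact ContinuousLinearMap.norm_id_le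

theorem opNorm_smul (c : ℂ) (A : Matrix ι ι ℂ) : opNorm (c • A) = ‖c‖ * opNorm A := by
  unfold opNorm
  rw [map_smul, norm_smul]

open scoped Matrix.Norms.L2Operator in
theorem opNorm_star_mul_self (A : Matrix ι ι ℂ) : opNorm (star A * A) = opNorm A * opNorm A :=
  Matrix.l2_opNorm_conjTranspose_mul_self A

theorem opNorm_le_one_of_star_mul_self {A : Matrix ι ι ℂ} (h : star A * A = 1) :
    opNorm A ≤ 1 := by
  have h1 := opNorm_star_mul_self A
  rw [h] at h1
  have h2 := opNorm_one_le (ι := ι)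
  nlinarith [opNorm_nonneg A]

theorem norm_apply_le_opNorm (A : Matrix ι ι ℂ) (i j : ι) : ‖A i j‖ ≤ opNorm A := by
  have h := ContinuousLinearMap.le_opNorm (Matrix.toEuclideanCLM (𝕜 := ℂ) A)
    (EuclideanSpace.single j 1)
  rw [PiLp.norm_single, norm_one, mul_one] at h
  refine le_trans ?_ h
  refine le_trans (le_of_eq ?_) (PiLp.norm_apply_le _ i)
  simp

/-! ### Functions of a Hermitian matrix -/

variable {A : Matrix ι ι ℂ}

/-- The matrix with the eigenvectors of `A` and the eigenvalues `f`. -/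
def specFun (hA : A.IsHermitian) (f : ι → ℝ) : Matrix ι ι ℂ :=
  (hA.eigenvectorUnitary : Matrix ι ι ℂ) * Matrix.diagonal (fun i => (f i : ℂ)) *
    star (hA.eigenvectorUnitary : Matrix ι ι ℂ)

theorem star_unitary_mul (hA : A.IsHermitian) :
    star (hA.eigenvectorUnitary : Matrix ι ι ℂ) * (hA.eigenvectorUnitary : Matrix ι ι ℂ) = 1 :=
  Unitary.coe_star_mul_self _

theorem unitary_mul_star (hA : A.IsHermitian) :
    (hA.eigenvectorUnitary : Matrix ι ι ℂ) * star (hA.eigenvectorUnitary : Matrix ι ι ℂ) = 1 :=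
  Unitary.coe_mul_star_self _

theorem specFun_eigenvalues (hA : A.IsHermitian) : specFun hA hA.eigenvalues = A := by
  conv_rhs => rw [hA.spectral_theorem]
  rfl

theorem specFun_mul (hA : A.IsHermitian) (f g : ι → ℝ) :
    specFun hA f * specFun hA g = specFun hA (fun i => f i * g i) := by
  unfold specFun
  calc _ = (hA.eigenvectorUnitary : Matrix ι ι ℂ) * Matrix.diagonal (fun i => (f i : ℂ)) *
      (star (hA.eigenvectorUnitary : Matrix ι ι ℂ) * (hA.eigenvectorUnitary : Matrix ι ι ℂ)) *
      Matrix.diagonal (fun i => (g i : ℂ)) * star (hA.eigenvectorUnitary : Matrix ι ι ℂ) := by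
        simp only [Matrix.mul_assoc]
    _ = _ := by
        rw [star_unitary_mul, Matrix.mul_one, Matrix.mul_assoc _ (Matrix.diagonal _)
          (Matrix.diagonal _), Matrix.diagonal_mul_diagonal]
        simp

theorem specFun_one (hA : A.IsHermitian) : specFun hA (fun _ => 1) = 1 := by
  simp only [specFun, Complex.ofReal_one, Matrix.diagonal_one, Matrix.mul_one]
  exact unitary_mul_star hA

theorem specFun_sub (hA : A.IsHermitian) (f g : ι → ℝ) :
    specFun hA f - specFun hA g = specFun hA (fun i => f i - g i) := by
  have : Matrix.diagonal (fun i => ((f i - g i : ℝ) : ℂ)) =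
      Matrix.diagonal (fun i => (f i : ℂ)) - Matrix.diagonal (fun i => (g i : ℂ)) := by
    rw [Matrix.diagonal_sub]; simp
  simp only [specFun, this, Matrix.mul_sub, Matrix.sub_mul]

theorem smul_specFun (hA : A.IsHermitian) (c : ℝ) (f : ι → ℝ) :
    (c : ℂ) • specFun hA f = specFun hA (fun i => c * f i) := by
  have : Matrix.diagonal (fun i => ((c * f i : ℝ) : ℂ)) =
      (c : ℂ) • Matrix.diagonal (fun i => (f i : ℂ)) := by
    rw [← Matrix.diagonal_smul]; congr 1; ext i; simp
  simp only [specFun, this, Matrix.mul_smul, Matrix.smul_mul]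

theorem trace_specFun (hA : A.IsHermitian) (f : ι → ℝ) :
    (specFun hA f).trace = ((∑ i, f i : ℝ) : ℂ) := by
  unfold specFun
  rw [Matrix.trace_mul_comm, ← Matrix.mul_assoc, star_unitary_mul, Matrix.one_mul,
    Matrix.trace_diagonal]
  simp

theorem trace_specFun_mul (hA : A.IsHermitian) (f : ι → ℝ) (Y : Matrix ι ι ℂ) :
    (specFun hA f * Y).trace = ∑ i, (f i : ℂ) *
      (star (hA.eigenvectorUnitary : Matrix ι ι ℂ) * Y * hA.eigenvectorUnitary) i i := by
  unfold specFun
  rw [Matrix.mul_assoc, Matrix.mul_assoc, Matrix.trace_mul_comm, Matrix.mul_assoc]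
  simp [Matrix.trace, Matrix.diagonal_mul]

theorem isHermitian_specFun (hA : A.IsHermitian) (f : ι → ℝ) : (specFun hA f).IsHermitian := by
  unfold specFun Matrix.IsHermitian
  rw [Matrix.conjTranspose_mul, Matrix.conjTranspose_mul, Matrix.diagonal_conjTranspose,
    ← Matrix.star_eq_conjTranspose, ← Matrix.star_eq_conjTranspose, star_star, Matrix.mul_assoc]
  congr 3
  ext i; simp

/-- In the eigenbasis the trace is the `f`-weighted sum of diagonal entries of a unitary conjugate
of `Y`, each bounded by the operator norm. -/
theorem norm_trace_specFun_mul_le (hA : A.IsHermitian) (f : ι → ℝ) (hf : ∀ i, 0 ≤ f i)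
    (Y : Matrix ι ι ℂ) : ‖(specFun hA f * Y).trace‖ ≤ (∑ i, f i) * opNorm Y := by
  rw [trace_specFun_mul, Finset.sum_mul]
  refine norm_sum_le_of_le _ fun i _ => ?_
  rw [norm_mul, Complex.norm_real, Real.norm_of_nonneg (hf i)]
  refine mul_le_mul_of_nonneg_left ?_ (hf i)
  refine (norm_apply_le_opNorm _ i i).trans ?_
  have hU : opNorm (hA.eigenvectorUnitary : Matrix ι ι ℂ) ≤ 1 :=
    opNorm_le_one_of_star_mul_self (star_unitary_mul hA)
  have hU' : opNorm (star (hA.eigenvectorUnitary : Matrix ι ι ℂ)) ≤ 1 :=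
    opNorm_le_one_of_star_mul_self (by rw [star_star]; exact unitary_mul_star hA)
  calc _ ≤ opNorm (star (hA.eigenvectorUnitary : Matrix ι ι ℂ) * Y) *
        opNorm (hA.eigenvectorUnitary : Matrix ι ι ℂ) := opNorm_mul_le _ _
    _ ≤ (opNorm (star (hA.eigenvectorUnitary : Matrix ι ι ℂ)) * opNorm Y) * 1 := by
        exact mul_le_mul (opNorm_mul_le _ _) hU (opNorm_nonneg _)
          (mul_nonneg (opNorm_nonneg _) (opNorm_nonneg _))
    _ ≤ 1 * opNorm Y * 1 := by
        gcongr
        exact opNorm_nonneg _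
    _ = _ := by ring

theorem trace_specFun_mul_sq_nonneg (hA : A.IsHermitian) (f : ι → ℝ) (hf : ∀ i, 0 ≤ f i)
    {Y : Matrix ι ι ℂ} (hY : Y.IsHermitian) : 0 ≤ (specFun hA f * (Y * Y)).trace.re := by
  rw [trace_specFun_mul, Complex.re_sum]
  refine Finset.sum_nonneg fun i _ => ?_
  rw [Complex.re_ofReal_mul]
  refine mul_nonneg (hf i) ?_
  have h : star (hA.eigenvectorUnitary : Matrix ι ι ℂ) * (Y * Y) * hA.eigenvectorUnitary =
      (Y * (hA.eigenvectorUnitary : Matrix ι ι ℂ))ᴴ * (Y * hA.eigenvectorUnitary) := by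
    rw [Matrix.conjTranspose_mul, hY.eq, Matrix.star_eq_conjTranspose]
    simp only [Matrix.mul_assoc]
  rw [h, Matrix.mul_apply, Complex.re_sum]
  refine Finset.sum_nonneg fun j _ => ?_
  rw [Matrix.conjTranspose_apply, Complex.star_def, ← Complex.normSq_eq_conj_mul_self]
  exact Complex.normSq_nonneg _

theorem trace_specFun_mul_im (hA : A.IsHermitian) (f : ι → ℝ)
    {Y : Matrix ι ι ℂ} (hY : Y.IsHermitian) : (specFun hA f * Y).trace.im = 0 := by
  have h : star (specFun hA f * Y).trace = (specFun hA f * Y).trace := by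
    rw [← Matrix.trace_conjTranspose, Matrix.conjTranspose_mul, hY.eq,
      (isHermitian_specFun hA f).eq, Matrix.trace_mul_comm]
  exact Complex.conj_eq_iff_im.mp h

/-- The Cauchy-Schwarz inequality for the state with the density matrix `specFun hA f`. -/
theorem sq_trace_specFun_mul_le (hA : A.IsHermitian) (f : ι → ℝ) (hf : ∀ i, 0 ≤ f i)
    (hf1 : ∑ i, f i = 1) {Y : Matrix ι ι ℂ} (hY : Y.IsHermitian) :
    (specFun hA f * Y).trace.re ^ 2 ≤ (specFun hA f * (Y * Y)).trace.re := by
  set c : ℝ := (specFun hA f * Y).trace.re with hc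
  have hH : (Y - (c : ℂ) • (1 : Matrix ι ι ℂ)).IsHermitian := by
    refine hY.sub ?_
    unfold Matrix.IsHermitian
    rw [Matrix.conjTranspose_smul, Matrix.conjTranspose_one]
    simp
  have h := trace_specFun_mul_sq_nonneg hA f hf hH
  have e : specFun hA f * ((Y - (c : ℂ) • (1 : Matrix ι ι ℂ)) * (Y - (c : ℂ) • 1)) =
      specFun hA f * (Y * Y) - (2 * c : ℂ) • (specFun hA f * Y) +
        (c * c : ℂ) • specFun hA f := by
    simp only [Matrix.sub_mul, Matrix.mul_sub, Matrix.smul_mul, Matrix.mul_smul, Matrix.mul_one,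
      Matrix.one_mul]
    module
  rw [e, Matrix.trace_add, Matrix.trace_sub, Matrix.trace_smul, Matrix.trace_smul,
    trace_specFun, hf1] at h
  have e2 : ((2 * c : ℂ) • (specFun hA f * Y).trace).re = 2 * c * c := by
    rw [smul_eq_mul, show (2 * c : ℂ) = ((2 * c : ℝ) : ℂ) by push_cast; ring,
      Complex.re_ofReal_mul]
  rw [Complex.add_re, Complex.sub_re, e2] at h
  simp at h
  nlinarith

/-- Cauchy-Schwarz applied repeatedly to `Y`, `Y²`, `Y⁴`, and so on. Restricting to powers of two
avoids a general Jensen inequality. -/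
theorem pow_trace_specFun_mul_le (hA : A.IsHermitian) (f : ι → ℝ) (hf : ∀ i, 0 ≤ f i)
    (hf1 : ∑ i, f i = 1) {Y : Matrix ι ι ℂ} (hY : Y.IsHermitian) (j : ℕ) :
    (specFun hA f * Y).trace.re ^ 2 ^ (j + 1) ≤ (specFun hA f * Y ^ 2 ^ (j + 1)).trace.re := by
  induction j with
  | zero => simpa [pow_two] using sq_trace_specFun_mul_le hA f hf hf1 hY
  | succ j ih =>
    have h0 : 0 ≤ (specFun hA f * Y).trace.re ^ 2 ^ (j + 1) := by
      rw [pow_succ, pow_mul]; positivity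
    calc (specFun hA f * Y).trace.re ^ 2 ^ (j + 1 + 1)
        = ((specFun hA f * Y).trace.re ^ 2 ^ (j + 1)) ^ 2 := by rw [← pow_mul, ← pow_succ]
      _ ≤ (specFun hA f * Y ^ 2 ^ (j + 1)).trace.re ^ 2 := by gcongr
      _ ≤ _ := by
        refine (sq_trace_specFun_mul_le hA f hf hf1 (hY.pow _)).trans (le_of_eq ?_)
        rw [← pow_add, ← two_mul, ← pow_succ' 2]

/-! ### The trace norm -/

/-- `f` and the eigenvalues of `B` agree only up to order, so they are compared as the multiset of
roots of the characteristic polynomial. -/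
theorem sum_eigenvalues_specFun (hA : A.IsHermitian) (f : ι → ℝ) {B : Matrix ι ι ℂ}
    (hB : B.IsHermitian) (h : B = specFun hA f) (g : ℝ → ℝ) :
    ∑ i, g (hB.eigenvalues i) = ∑ i, g (f i) := by
  have h1 := hB.roots_charpoly_eq_eigenvalues
  have h2 : B.charpoly = ∏ i, (Polynomial.X - Polynomial.C (f i : ℂ)) := by
    rw [h, specFun, Matrix.charpoly_mul_comm, ← Matrix.mul_assoc, star_unitary_mul, Matrix.one_mul,
      Matrix.charpoly_diagonal]
  have h3 : B.charpoly.roots = Multiset.map (fun i => (f i : ℂ)) Finset.univ.val := by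
    rw [h2, Polynomial.roots_prod]
    · simp
    · simp [Finset.prod_ne_zero_iff, Polynomial.X_sub_C_ne_zero]
  rw [h3] at h1
  have h4 := congrArg (fun s => (s.map (fun z : ℂ => g z.re)).sum) h1
  simp only [Multiset.map_map, Function.comp_def] at h4
  simpa using h4.symm

/-- The trace norm of a Hermitian matrix is attained by a Hermitian involution. -/
theorem exists_traceNorm_eq {X : Matrix ι ι ℂ} (hX : X.IsHermitian) :
    ∃ a : Matrix ι ι ℂ, a.IsHermitian ∧ a * a = 1 ∧ ((X * a).trace = (traceNorm X : ℂ)) := by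
  -- The sign is set to `1` on the kernel, so that the operator squares to the identity.
  set s : ι → ℝ := fun i => if 0 ≤ hX.eigenvalues i then 1 else -1 with hs
  refine ⟨specFun hX s, isHermitian_specFun _ _, ?_, ?_⟩
  · rw [specFun_mul, ← specFun_one hX]
    congr 1; ext i; simp only [hs]; split_ifs <;> norm_num
  · have e : traceNorm X = ∑ i, |hX.eigenvalues i| := by
      unfold traceNorm
      rw [sum_eigenvalues_specFun hX (fun i => hX.eigenvalues i * hX.eigenvalues i) _ ?_ Real.sqrt]
      · exact Finset.sum_congr rfl fun i _ => Real.sqrt_mul_self_eq_abs _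
      · rw [hX.eq, ← specFun_mul, specFun_eigenvalues]
    nth_rewrite 1 [← specFun_eigenvalues hX]
    rw [specFun_mul, trace_specFun, e]
    congr 1
    refine Finset.sum_congr rfl fun i _ => ?_
    simp only [hs]
    split_ifs with h
    · rw [abs_of_nonneg h, mul_one]
    · rw [abs_of_neg (not_le.mp h)]; ring

end LinearAlgebra

section Ensembles

variable {V : Type} [Fintype V] [DecidableEq V]

/-! ### The two ensembles in the eigenbasis of the Hamiltonian -/

/-- The partition function. -/
def partitionFn {H : Op V} (hH : H.IsHermitian) (β : ℝ) : ℝ :=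
  ∑ m, Real.exp (-β * hH.eigenvalues m)

theorem partitionFn_pos {H : Op V} (hH : H.IsHermitian) (β : ℝ) : 0 < partitionFn hH β :=
  Finset.sum_pos (fun _ _ => Real.exp_pos _) Finset.univ_nonempty

/-- The Boltzmann weights. -/
def gibbs {H : Op V} (hH : H.IsHermitian) (β : ℝ) (m : Config V) : ℝ :=
  (partitionFn hH β)⁻¹ * Real.exp (-β * hH.eigenvalues m)

theorem gibbs_nonneg {H : Op V} (hH : H.IsHermitian) (β : ℝ) (m : Config V) :
    0 ≤ gibbs hH β m :=
  mul_nonneg (inv_nonneg.mpr (partitionFn_pos hH β).le) (Real.exp_pos _).le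

theorem sum_gibbs {H : Op V} (hH : H.IsHermitian) (β : ℝ) : ∑ m, gibbs hH β m = 1 := by
  unfold gibbs
  rw [← Finset.mul_sum]
  exact inv_mul_cancel₀ (partitionFn_pos hH β).ne'

theorem exp_smul_eq_specFun {H : Op V} (hH : H.IsHermitian) (β : ℝ) :
    NormedSpace.exp (-(β : ℂ) • H) = specFun hH (fun m => Real.exp (-β * hH.eigenvalues m)) := by
  have h1 : -(β : ℂ) • H = specFun hH (fun m => -β * hH.eigenvalues m) := by
    rw [← smul_specFun, specFun_eigenvalues]; simp
  have hinv : (hH.eigenvectorUnitary : Op V)⁻¹ = star (hH.eigenvectorUnitary : Op V) :=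
    Matrix.inv_eq_right_inv (unitary_mul_star hH)
  have hu : IsUnit (hH.eigenvectorUnitary : Op V) :=
    (Unitary.toUnits hH.eigenvectorUnitary).isUnit
  rw [h1, specFun, ← hinv, Matrix.exp_conj _ _ hu, Matrix.exp_diagonal, hinv, specFun]
  congr 3
  ext m
  rw [Pi.coe_exp, ← Complex.exp_eq_exp_ℂ, Complex.ofReal_exp]

theorem canonical_eq_specFun {H : Op V} (hH : H.IsHermitian) (β : ℝ) :
    canonical H β = specFun hH (gibbs hH β) := by
  unfold canonical
  rw [exp_smul_eq_specFun hH, trace_specFun, ← Complex.ofReal_inv, smul_specFun]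
  rfl

/-- The microcanonical weights. -/
def shellWeight {H : Op V} (hH : H.IsHermitian) (E Δ : ℝ) (m : Config V) : ℝ :=
  (shellCount hH E Δ : ℝ)⁻¹ * if m ∈ shell hH E Δ then 1 else 0

theorem shellWeight_nonneg {H : Op V} (hH : H.IsHermitian) (E Δ : ℝ) (m : Config V) :
    0 ≤ shellWeight hH E Δ m := by
  unfold shellWeight
  split_ifs <;> positivity

theorem sum_shellWeight {H : Op V} (hH : H.IsHermitian) {E Δ : ℝ} (h : 0 < shellCount hH E Δ) :
    ∑ m, shellWeight hH E Δ m = 1 := by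
  unfold shellWeight
  rw [← Finset.mul_sum, Finset.sum_ite_mem, Finset.univ_inter, Finset.sum_const, nsmul_eq_mul,
    mul_one]
  exact inv_mul_cancel₀ (by exact_mod_cast h.ne')

theorem microcanonical_eq_specFun {H : Op V} (hH : H.IsHermitian) (E Δ : ℝ) :
    microcanonical hH E Δ = specFun hH (shellWeight hH E Δ) := by
  have h : (∑ m ∈ shell hH E Δ, Matrix.vecMulVec (fun σ => hH.eigenvectorBasis m σ)
      (fun σ => star (hH.eigenvectorBasis m σ))) =
      specFun hH (fun m => if m ∈ shell hH E Δ then 1 else 0) := by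
    ext σ τ
    rw [Matrix.sum_apply, specFun, Matrix.mul_apply]
    simp only [Matrix.mul_diagonal, Matrix.vecMulVec_apply]
    rw [← Finset.sum_subset (Finset.subset_univ (shell hH E Δ))]
    · refine Finset.sum_congr rfl fun m hm => ?_
      simp [hm]
    · intro m _ hm
      simp [hm]
  unfold microcanonical
  rw [h, show ((shellCount hH E Δ : ℂ)⁻¹) = (((shellCount hH E Δ : ℝ)⁻¹ : ℝ) : ℂ) by push_cast; rfl,
    smul_specFun]
  rfl

end Ensembles

section Supports

variable {V : Type} [Fintype V] [DecidableEq V]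

/-! ### Local operators -/

/-- A configuration is a configuration on `X` together with one outside `X`. -/
def splitConfig (X : Finset V) : Config V ≃ Config X × Config {i : V // i ∉ X} :=
  Equiv.piEquivPiSubtypeProd (fun i => i ∈ X) (fun _ => Fin 2)

theorem splitConfig_symm (X : Finset V) (p : Config X × Config {i : V // i ∉ X}) :
    (splitConfig X).symm p = glue X p.1 p.2 := rfl

theorem embed_eq_kronecker (X : Finset V) (a : Op X) :
    embed X a = (Matrix.kronecker a (1 : Op {i : V // i ∉ X})).submatrix
      (splitConfig X) (splitConfig X) := by
  ext σ τ
  simp only [embed, Matrix.submatrix_apply, Matrix.kronecker, Matrix.kroneckerMap_apply,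
    Matrix.one_apply, splitConfig, Equiv.piEquivPiSubtypeProd_apply, mul_ite, mul_one, mul_zero,
    funext_iff, Subtype.forall]

theorem embed_mul (X : Finset V) (a b : Op X) : embed X (a * b) = embed X a * embed X b := by
  rw [embed_eq_kronecker, embed_eq_kronecker, embed_eq_kronecker, Matrix.submatrix_mul_equiv]
  simp only [Matrix.kronecker]
  rw [← Matrix.mul_kronecker_mul, Matrix.mul_one]

theorem embed_one (X : Finset V) : embed X (1 : Op X) = 1 := by
  rw [embed_eq_kronecker, Matrix.kronecker, Matrix.one_kronecker_one, Matrix.submatrix_one_equiv]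

theorem embed_sub (X : Finset V) (a b : Op X) : embed X (a - b) = embed X a - embed X b := by
  ext σ τ
  simp only [embed, Matrix.sub_apply]
  split_ifs <;> simp

theorem embed_smul (X : Finset V) (c : ℂ) (a : Op X) : embed X (c • a) = c • embed X a := by
  ext σ τ
  simp only [embed, Matrix.smul_apply]
  split_ifs <;> simp

theorem isHermitian_embed {X : Finset V} {a : Op X} (ha : a.IsHermitian) :
    (embed X a).IsHermitian := by
  ext σ τ
  simp only [embed, Matrix.conjTranspose_apply]
  have h := ha.apply (fun i : X => σ i) (fun i => τ i)
  by_cases hc : ∀ i, i ∉ X → σ i = τ i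
  · rw [if_pos hc, if_pos fun i hi => (hc i hi).symm, h]
  · rw [if_neg hc, if_neg fun h' => hc fun i hi => (h' i hi).symm, star_zero]

theorem SupportedOn.mono {X Y : Finset V} (h : X ⊆ Y) {A : Op V} (hA : SupportedOn X A) :
    SupportedOn Y A := by
  obtain ⟨a, rfl⟩ := hA
  -- The witness is `a` tensored with the identity on `Y \ X`.
  refine ⟨Matrix.of fun σ τ => if ∀ i : Y, (i : V) ∉ X → σ i = τ i then
    a (fun i => σ ⟨i, h i.2⟩) (fun i => τ ⟨i, h i.2⟩) else 0, ?_⟩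
  ext σ τ
  simp only [embed, Matrix.of_apply]
  by_cases hc : ∀ i, i ∉ X → σ i = τ i
  · have h1 : ∀ i, i ∉ Y → σ i = τ i := fun i hi => hc i fun hx => hi (h hx)
    have h2 : ∀ i : Y, (i : V) ∉ X → σ i = τ i := fun i hi => hc i hi
    rw [if_pos hc, if_pos h1, if_pos h2]
  · rw [if_neg hc]
    split_ifs with h1 h2
    · refine absurd (fun i hi => ?_) hc
      by_cases hY : i ∈ Y
      · exact h2 ⟨i, hY⟩ hi
      · exact h1 i hY
    · rfl
    · rfl

theorem supportedOn_one (X : Finset V) : SupportedOn X (1 : Op V) := ⟨1, (embed_one X).symm⟩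

theorem SupportedOn.mul {X : Finset V} {A B : Op V} (hA : SupportedOn X A)
    (hB : SupportedOn X B) : SupportedOn X (A * B) := by
  obtain ⟨a, rfl⟩ := hA
  obtain ⟨b, rfl⟩ := hB
  exact ⟨a * b, (embed_mul X a b).symm⟩

/-- Only one intermediate configuration contributes: `τ` on `X` and `σ` elsewhere. The resulting
formula is symmetric in the two factors, which gives commutation. -/
theorem embed_mul_embed_apply {X Y : Finset V} (h : Disjoint X Y) (a : Op X) (b : Op Y)
    (σ τ : Config V) : (embed X a * embed Y b) σ τ =
      if ∀ i, i ∉ X → i ∉ Y → σ i = τ i then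
        a (fun i => σ i) (fun i => τ i) * b (fun i => σ i) (fun i => τ i) else 0 := by
  rw [Matrix.mul_apply]
  set υ : Config V := fun i => if i ∈ X then τ i else σ i with hυ
  rw [Finset.sum_eq_single υ]
  · have h1 : ∀ i, i ∉ X → σ i = υ i := fun i hi => by simp [hυ, hi]
    have h2 : (fun i : X => υ i) = fun i : X => τ i := by
      ext i; simp [hυ]
    have h3 : (fun i : Y => υ i) = fun i : Y => σ i := by
      ext i
      have : (i : V) ∉ X := fun hi => Finset.disjoint_left.mp h hi i.2
      simp [hυ, this]
    simp only [embed]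
    rw [if_pos h1, h2, h3, mul_ite, mul_zero]
    congr 1
    refine propext ⟨fun hc i hX hY => ?_, fun hc i hY => ?_⟩
    · rw [h1 i hX]; exact hc i hY
    · by_cases hX : i ∈ X
      · simp [hυ, hX]
      · rw [← h1 i hX]; exact hc i hX hY
  · intro υ' _ hne
    simp only [embed]
    by_cases h1 : ∀ i, i ∉ X → σ i = υ' i
    · by_cases h2 : ∀ i, i ∉ Y → υ' i = τ i
      · refine absurd ?_ hne
        ext i
        by_cases hX : i ∈ X
        · simp [hυ, hX, h2 i (Finset.disjoint_left.mp h hX)]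
        · simp [hυ, hX, h1 i hX]
      · rw [if_neg h2, mul_zero]
    · rw [if_neg h1, zero_mul]
  · exact fun hn => absurd (Finset.mem_univ _) hn

theorem SupportedOn.commute {X Y : Finset V} (h : Disjoint X Y) {A B : Op V}
    (hA : SupportedOn X A) (hB : SupportedOn Y B) : A * B = B * A := by
  obtain ⟨a, rfl⟩ := hA
  obtain ⟨b, rfl⟩ := hB
  ext σ τ
  rw [embed_mul_embed_apply h, embed_mul_embed_apply h.symm, mul_comm]
  congr 1
  exact propext ⟨fun hc i hY hX => hc i hX hY, fun hc i hX hY => hc i hY hX⟩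

/-! ### Reduced density matrices -/

theorem reduced_sub (B : Finset V) (ρ ρ' : Op V) :
    reduced B (ρ - ρ') = reduced B ρ - reduced B ρ' := by
  ext σ τ
  simp [reduced, Finset.sum_sub_distrib]

theorem isHermitian_reduced (B : Finset V) {ρ : Op V} (hρ : ρ.IsHermitian) :
    (reduced B ρ).IsHermitian := by
  ext σ τ
  simp only [reduced, Matrix.conjTranspose_apply, star_sum]
  exact Finset.sum_congr rfl fun η _ => hρ.apply _ _

/-- Duality of partial trace and embedding; it turns trace norms on blocks into expectation values
on the whole lattice. -/
theorem trace_reduced_mul (B : Finset V) (ρ : Op V) (a : Op B) :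
    (reduced B ρ * a).trace = (ρ * embed B a).trace := by
  have h : (ρ * embed B a).trace =
      ((ρ.submatrix (splitConfig B).symm (splitConfig B).symm) *
        (Matrix.kronecker a (1 : Op {i : V // i ∉ B}))).trace := by
    have e : Matrix.kronecker a (1 : Op {i : V // i ∉ B}) =
        (embed B a).submatrix (splitConfig B).symm (splitConfig B).symm := by
      rw [embed_eq_kronecker, Matrix.submatrix_submatrix]; simp
    rw [e, Matrix.submatrix_mul_equiv]
    simp only [Matrix.trace, Matrix.diag_apply, Matrix.submatrix_apply]
    exact ((splitConfig B).symm.sum_comp (fun σ => (ρ * embed B a) σ σ)).symm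
  rw [h]
  simp only [Matrix.trace, Matrix.diag_apply, Matrix.mul_apply, Fintype.sum_prod_type,
    Matrix.submatrix_apply, splitConfig_symm, Matrix.kronecker, Matrix.kroneckerMap_apply,
    Matrix.one_apply, mul_ite, mul_one, mul_zero, Finset.sum_ite_eq', Finset.mem_univ, if_true,
    reduced, Finset.sum_mul]
  refine Finset.sum_congr rfl fun σ _ => ?_
  rw [Finset.sum_comm]

end Supports

section Moments

/-! ### A moment bound for weakly dependent variables -/

open Classical in
/-- A graph on `2k` vertices without isolated vertices has a dominating set of size `k`. -/
theorem exists_dominating {k : ℕ} (g : Fin (2 * k) → Fin (2 * k) → Prop)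
    (hsymm : ∀ i j, g i j → g j i) (h : ∀ i, ∃ j, j ≠ i ∧ g i j) :
    ∃ S : Finset (Fin (2 * k)), S.card = k ∧ ∀ i, i ∉ S → ∃ j ∈ S, g j i := by
  -- A maximal independent set dominates by maximality, and its complement dominates because no
  -- vertex is isolated. The smaller of the two has at most `k` elements and is padded to exactly
  -- `k`.
  obtain ⟨I, -, hI⟩ := Finite.exists_le_maximal
    (p := fun I : Finset (Fin (2 * k)) => ∀ i ∈ I, ∀ j ∈ I, i ≠ j → ¬ g i j) (a := ∅) (by simp)
  have h1 : ∀ i, i ∉ I → ∃ j ∈ I, g j i := by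
    intro i hi
    by_contra! hc
    refine hi (hI.2 (y := insert i I) ?_ (Finset.subset_insert i I) (Finset.mem_insert_self i I))
    intro a ha c hcI hac
    rcases Finset.mem_insert.mp ha with rfl | ha' <;>
      rcases Finset.mem_insert.mp hcI with rfl | hcI'
    · exact absurd rfl hac
    · exact fun hg => hc c hcI' (hsymm _ _ hg)
    · exact hc a ha'
    · exact hI.1 a ha' c hcI' hac
  have h2 : ∀ i, i ∉ Iᶜ → ∃ j ∈ Iᶜ, g j i := by
    intro i hi
    have hi : i ∈ I := by simpa using hi
    obtain ⟨j, hji, hg⟩ := h i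
    refine ⟨j, ?_, hsymm _ _ hg⟩
    rw [Finset.mem_compl]
    exact fun hj => hI.1 i hi j hj hji.symm hg
  have key : ∃ S : Finset (Fin (2 * k)), S.card ≤ k ∧ ∀ i, i ∉ S → ∃ j ∈ S, g j i := by
    have hc : Iᶜ.card = 2 * k - I.card := by rw [Finset.card_compl, Fintype.card_fin]
    rcases le_total I.card k with hle | hle
    · exact ⟨I, hle, h1⟩
    · exact ⟨Iᶜ, by omega, h2⟩
  obtain ⟨S, hS, hd⟩ := key
  obtain ⟨T, hST, hT⟩ := Finset.exists_superset_card_eq hS (by rw [Fintype.card_fin]; omega)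
  refine ⟨T, hT, fun i hi => ?_⟩
  obtain ⟨j, hj, hg⟩ := hd i fun h => hi (hST h)
  exact ⟨j, hST hj, hg⟩

variable {ι : Type*} [Fintype ι] [DecidableEq ι]

open Classical in
-- The entries indexed by `S` are free; each remaining entry lies in the union of their
-- neighbourhoods, which has at most `S.card * v` points.
theorem card_dominated_tuples_le {m : ℕ} (adj : ι → ι → Prop) (v : ℕ)
    (hv : ∀ a, (Finset.univ.filter fun c => adj a c).card ≤ v) (S : Finset (Fin m)) :
    (Finset.univ.filter fun t : Fin m → ι => ∀ i, i ∉ S → ∃ j ∈ S, adj (t j) (t i)).card ≤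
      (S.card * v) ^ (m - S.card) * Fintype.card ι ^ S.card := by
  refine (Finset.card_le_mul_card_image (f := fun t : Fin m → ι => fun j : S => t j) _
    ((S.card * v) ^ (m - S.card)) ?_).trans ?_
  · intro a _
    set U : Finset ι := Finset.univ.biUnion fun j : S => Finset.univ.filter fun c => adj (a j) c
      with hU
    have hUcard : U.card ≤ S.card * v := by
      refine Finset.card_biUnion_le.trans ((Finset.sum_le_card_nsmul _ _ v fun j _ => hv _).trans ?_)
      simp
    refine (Finset.card_le_card_of_injOn (t := Fintype.piFinset fun _ : {i : Fin m // i ∉ S} => U)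
      (fun t => fun i => t i) ?_ ?_).trans ?_
    · intro t ht
      simp only [Finset.coe_filter, Finset.mem_filter, Finset.mem_univ, true_and,
        Set.mem_ofPred_eq] at ht
      obtain ⟨h1, h2⟩ := ht
      rw [Finset.mem_coe, Fintype.mem_piFinset]
      intro i
      obtain ⟨j, hj, hadj⟩ := h1 i i.2
      simp only [hU, Finset.mem_biUnion, Finset.mem_univ, true_and, Finset.mem_filter]
      exact ⟨⟨j, hj⟩, by rw [← h2]; exact hadj⟩
    · intro t ht t' ht' heq
      simp only [Finset.coe_filter, Finset.mem_filter, Finset.mem_univ, true_and,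
        Set.mem_ofPred_eq] at ht ht'
      have e : (fun j : S => t j) = fun j : S => t' j := ht.2.trans ht'.2.symm
      funext i
      by_cases hi : i ∈ S
      · exact congrFun e ⟨i, hi⟩
      · exact congrFun heq ⟨i, hi⟩
    · rw [Fintype.card_piFinset, Finset.prod_const, Finset.card_univ]
      have : Fintype.card {i : Fin m // i ∉ S} = m - S.card := by
        rw [Fintype.card_subtype_compl]; simp
      rw [this]
      exact Nat.pow_le_pow_left hUcard _
  · refine Nat.mul_le_mul_left _ ((Finset.card_le_univ _).trans ?_)
    simp

open Classical in
-- Union bound over dominating sets of size `k`, of which there are at most `(2k choose k) ≤ 4 ^ k`.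
-- Only the `k`-th power of the number of points appears, hence the square-root cancellation.
theorem card_linked_tuples_le {k : ℕ} (adj : ι → ι → Prop) (hsymm : ∀ a c, adj a c → adj c a)
    (v : ℕ) (hv : ∀ a, (Finset.univ.filter fun c => adj a c).card ≤ v) :
    (Finset.univ.filter fun t : Fin (2 * k) → ι => ∀ i, ∃ j, j ≠ i ∧ adj (t i) (t j)).card ≤
      4 ^ k * (Fintype.card ι * k) ^ k * v ^ k := by
  have hsub : (Finset.univ.filter fun t : Fin (2 * k) → ι =>
      ∀ i, ∃ j, j ≠ i ∧ adj (t i) (t j)) ⊆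
      (Finset.powersetCard k (Finset.univ : Finset (Fin (2 * k)))).biUnion fun S =>
        Finset.univ.filter fun t : Fin (2 * k) → ι => ∀ i, i ∉ S → ∃ j ∈ S, adj (t j) (t i) := by
    intro t ht
    obtain ⟨S, hS, hd⟩ := exists_dominating (fun i j => adj (t i) (t j))
      (fun i j => hsymm _ _) (Finset.mem_filter.mp ht).2
    exact Finset.mem_biUnion.mpr ⟨S, Finset.mem_powersetCard.mpr ⟨Finset.subset_univ _, hS⟩,
      Finset.mem_filter.mpr ⟨Finset.mem_univ _, hd⟩⟩
  refine (Finset.card_le_card hsub).trans (Finset.card_biUnion_le.trans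
    ((Finset.sum_le_card_nsmul _ _ ((k * v) ^ k * Fintype.card ι ^ k) ?_).trans ?_))
  · intro S hS
    have hc := (Finset.mem_powersetCard.mp hS).2
    refine (card_dominated_tuples_le adj v hv S).trans (le_of_eq ?_)
    rw [hc]
    congr 2
    omega
  · rw [Finset.card_powersetCard, Finset.card_univ, Fintype.card_fin, smul_eq_mul]
    have : (2 * k).choose k ≤ 4 ^ k := by
      have := Nat.choose_le_two_pow (2 * k) k
      rwa [pow_mul] at this
    calc _ ≤ 4 ^ k * ((k * v) ^ k * Fintype.card ι ^ k) := Nat.mul_le_mul_right _ this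
      _ = _ := by rw [mul_pow, mul_pow]; ring

/-- The moment bound: `φ` plays the role of an expectation value, the variables `x i` sit at
points with distances `δ`, and a product of `2k` variables has a small expectation value when one
of them is isolated. -/
theorem norm_moment_le {R : Type*} [CommRing R] (φ : R →+ ℂ) (x : ι → R) (δ : ι → ι → ℕ)
    (hsymm : ∀ a c, δ a c = δ c a) {k : ℕ} (hk : 1 ≤ k) {b W : ℝ} (hb : 0 ≤ b) (e : ℕ → ℝ)
    (he : ∀ D, 0 ≤ e D)
    (hφ : ∀ (t : Fin (2 * k) → ι) (i : Fin (2 * k)) (D : ℕ), (∀ j, j ≠ i → D ≤ δ (t i) (t j)) →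
      ‖φ (∏ j, x (t j))‖ ≤ b * e D)
    (v : ℕ → ℕ) (hv : ∀ D a, (Finset.univ.filter fun c => δ a c ≤ D).card ≤ v D)
    (hW : ∀ N, ∑ D ∈ Finset.range N, e D * (v D : ℝ) ^ k ≤ W) :
    ‖φ ((∑ a, x a) ^ (2 * k))‖ ≤ b * (4 ^ k * (Fintype.card ι * k) ^ k * W) := by
  classical
  have hex : ∀ t : Fin (2 * k) → ι, ∃ D, ∀ i, ∃ j, j ≠ i ∧ δ (t i) (t j) ≤ D := by
    intro t
    refine ⟨∑ i, ∑ j, δ (t i) (t j), fun i => ?_⟩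
    have hnt : Nontrivial (Fin (2 * k)) := Fin.nontrivial_iff_two_le.mpr (by omega)
    obtain ⟨j, hj⟩ := exists_ne i
    refine ⟨j, hj, ?_⟩
    calc δ (t i) (t j) ≤ ∑ j, δ (t i) (t j) :=
          Finset.single_le_sum (f := fun j => δ (t i) (t j)) (fun _ _ => Nat.zero_le _)
            (Finset.mem_univ j)
      _ ≤ _ := Finset.single_le_sum (f := fun i => ∑ j, δ (t i) (t j)) (fun _ _ => Nat.zero_le _)
            (Finset.mem_univ i)
  -- The least scale at which no entry is isolated. Being a valid scale controls the number of
  -- tuples; being minimal provides an entry at distance at least `ρ t` from all others.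
  set ρ : (Fin (2 * k) → ι) → ℕ := fun t => Nat.find (hex t) with hρ
  have hρ1 : ∀ t, ∀ i, ∃ j, j ≠ i ∧ δ (t i) (t j) ≤ ρ t := fun t => Nat.find_spec (hex t)
  have hρ2 : ∀ t, ∃ i, ∀ j, j ≠ i → ρ t ≤ δ (t i) (t j) := by
    intro t
    rcases Nat.eq_zero_or_pos (ρ t) with h0 | h0
    · exact ⟨⟨0, by omega⟩, fun j _ => by omega⟩
    · have := Nat.find_min (hex t) (m := ρ t - 1) (by simp only [hρ] at h0 ⊢; omega)
      push Not at this
      obtain ⟨i, hi⟩ := this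
      exact ⟨i, fun j hj => by have := hi j hj; omega⟩
  set N : ℕ := (Finset.univ.sup ρ) + 1 with hN
  rw [Fintype.sum_pow, map_sum]
  calc ‖∑ t : Fin (2 * k) → ι, φ (∏ j, x (t j))‖
      ≤ ∑ t : Fin (2 * k) → ι, b * e (ρ t) := by
        refine norm_sum_le_of_le _ fun t _ => ?_
        obtain ⟨i, hi⟩ := hρ2 t
        exact hφ t i _ hi
    _ = ∑ D ∈ Finset.range N, ∑ t with ρ t = D, b * e (ρ t) := by
        refine (Finset.sum_fiberwise_of_maps_to (fun t _ => ?_) _).symm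
        rw [Finset.mem_range, hN, Nat.lt_succ_iff]
        exact Finset.le_sup (Finset.mem_univ t)
    _ ≤ ∑ D ∈ Finset.range N, b * (4 ^ k * (Fintype.card ι * k) ^ k * (e D * (v D : ℝ) ^ k)) := by
        refine Finset.sum_le_sum fun D _ => ?_
        have h1 : ∑ t with ρ t = D, b * e (ρ t) =
            (Finset.univ.filter fun t => ρ t = D).card * (b * e D) := by
          rw [Finset.sum_congr rfl (g := fun _ => b * e D), Finset.sum_const, nsmul_eq_mul]
          intro t ht
          rw [(Finset.mem_filter.mp ht).2]
        have h2 : (Finset.univ.filter fun t => ρ t = D).card ≤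
            4 ^ k * (Fintype.card ι * k) ^ k * v D ^ k := by
          refine (Finset.card_le_card ?_).trans (card_linked_tuples_le (fun a c => δ a c ≤ D)
            (fun a c h => by rwa [hsymm]) (v D) fun a => by convert hv D a)
          intro t ht
          simp only [Finset.mem_filter, Finset.mem_univ, true_and]
          intro i
          rw [← (Finset.mem_filter.mp ht).2]
          exact hρ1 t i
        have h3 : ((Finset.univ.filter fun t => ρ t = D).card : ℝ) ≤
            4 ^ k * (Fintype.card ι * k) ^ k * (v D : ℝ) ^ k := by exact_mod_cast h2
        rw [h1]
        calc _ ≤ (4 ^ k * (Fintype.card ι * k) ^ k * (v D : ℝ) ^ k) * (b * e D) :=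
              mul_le_mul_of_nonneg_right h3 (mul_nonneg hb (he D))
          _ = _ := by ring
    _ = b * (4 ^ k * (Fintype.card ι * k) ^ k * ∑ D ∈ Finset.range N, e D * (v D : ℝ) ^ k) := by
        rw [Finset.mul_sum, Finset.mul_sum]
    _ ≤ _ := by
        gcongr
        exact hW N

end Moments

section Geometry

/-! ### Counting lattice sites and cubes -/

variable {d : ℕ}

theorem manhattan_self (x : Fin d → ℤ) : manhattan x x = 0 := by simp [manhattan]

theorem manhattan_comm (x y : Fin d → ℤ) : manhattan x y = manhattan y x :=
  Finset.sum_congr rfl fun k _ => by omega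

theorem manhattan_triangle (x y z : Fin d → ℤ) :
    manhattan x z ≤ manhattan x y + manhattan y z := by
  unfold manhattan
  rw [← Finset.sum_add_distrib]
  exact Finset.sum_le_sum fun k _ => by omega

theorem natAbs_sub_le_manhattan (x y : Fin d → ℤ) (k : Fin d) :
    (x k - y k).natAbs ≤ manhattan x y :=
  Finset.single_le_sum (f := fun k => (x k - y k).natAbs) (fun _ _ => Nat.zero_le _)
    (Finset.mem_univ k)

variable {Λ : Finset (Fin d → ℤ)}

theorem setDist_comm (X Y : Finset Λ) : setDist X Y = setDist Y X := by
  unfold setDist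
  congr 1
  ext m
  constructor <;> rintro ⟨i, hi, j, hj, h⟩ <;> exact ⟨j, hj, i, hi, by rw [h, manhattan_comm]⟩

theorem exists_manhattan_eq_setDist {X Y : Finset Λ} (hX : X.Nonempty) (hY : Y.Nonempty) :
    ∃ i ∈ X, ∃ j ∈ Y, setDist X Y = manhattan i.1 j.1 := by
  obtain ⟨i, hi⟩ := hX
  obtain ⟨j, hj⟩ := hY
  exact Nat.sInf_mem (s := {m | ∃ i ∈ X, ∃ j ∈ Y, m = manhattan i.1 j.1}) ⟨_, i, hi, j, hj, rfl⟩

theorem setDist_le {X Y : Finset Λ} {i j : Λ} (hi : i ∈ X) (hj : j ∈ Y) :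
    setDist X Y ≤ manhattan i.1 j.1 := Nat.sInf_le ⟨i, hi, j, hj, rfl⟩

theorem card_sites_le (i : Λ) (D : ℕ) :
    (Finset.univ.filter fun j : Λ => manhattan i.1 j.1 ≤ D).card ≤ (2 * D + 1) ^ d := by
  have h := Finset.card_le_card_of_injOn (s := Finset.univ.filter fun j : Λ => manhattan i.1 j.1 ≤ D)
    (t := Fintype.piFinset fun k => Finset.Icc (i.1 k - D) (i.1 k + D)) (fun j => j.1) ?_
    (fun _ _ _ _ h => Subtype.ext h)
  · refine h.trans (le_of_eq ?_)
    rw [Fintype.card_piFinset]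
    simp only [Int.card_Icc]
    rw [Finset.prod_congr rfl (g := fun _ => 2 * D + 1) fun k _ => by omega]
    simp
  · intro j hj
    have hj : manhattan i.1 j.1 ≤ D := by simpa using hj
    rw [Finset.mem_coe, Fintype.mem_piFinset]
    intro k
    have := natAbs_sub_le_manhattan i.1 j.1 k
    change j.1 k ∈ _
    rw [Finset.mem_Icc]
    omega

theorem card_cube (ℓ : ℕ) (c : Fin d → ℤ) : (cube ℓ c).card = ℓ ^ d := by
  unfold cube
  rw [Fintype.card_piFinset]
  simp

theorem block_nonempty {ℓ : ℕ} (hℓ : 1 ≤ ℓ) {C : Finset (Fin d → ℤ)}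
    (hC : IsCubePartition Λ ℓ C) {c : Fin d → ℤ} (hc : c ∈ C) : (block Λ ℓ c).Nonempty := by
  have h : c ∈ cube ℓ c := by
    refine Fintype.mem_piFinset.mpr fun k => Finset.mem_Ico.mpr ?_
    omega
  have hΛ : c ∈ Λ := by
    rw [← hC.2]
    exact Finset.mem_biUnion.mpr ⟨c, hc, h⟩
  exact ⟨⟨c, hΛ⟩, Finset.mem_filter.mpr ⟨Finset.mem_univ _, h⟩⟩

theorem block_disjoint {ℓ : ℕ} {C : Finset (Fin d → ℤ)}
    (hC : IsCubePartition Λ ℓ C) {c c' : Fin d → ℤ} (hc : c ∈ C) (hc' : c' ∈ C) (h : c ≠ c') :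
    Disjoint (block Λ ℓ c) (block Λ ℓ c') := by
  rw [Finset.disjoint_left]
  intro i hi hi'
  exact Finset.disjoint_left.mp (hC.1 hc hc' h) (Finset.mem_filter.mp hi).2
    (Finset.mem_filter.mp hi').2

theorem card_eq_of_partition {ℓ : ℕ} {C : Finset (Fin d → ℤ)} (hC : IsCubePartition Λ ℓ C) :
    Λ.card = C.card * ℓ ^ d := by
  rw [← hC.2, Finset.card_biUnion]
  · simp [card_cube]
  · exact fun c hc c' hc' h => hC.1 hc hc' h

/-- Volume comparison: the nearby cubes are disjoint and fit into a box that extends the given cube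
by `D + ℓ` on every side. -/
theorem card_near_cubes_mul_le {ℓ : ℕ} (hℓ : 1 ≤ ℓ) {C : Finset (Fin d → ℤ)}
    (hC : IsCubePartition Λ ℓ C) (c : C) (D : ℕ) :
    (Finset.univ.filter fun c' : C => setDist (block Λ ℓ c) (block Λ ℓ c') ≤ D).card * ℓ ^ d ≤
      (2 * D + 3 * ℓ) ^ d := by
  set T := Finset.univ.filter fun c' : C => setDist (block Λ ℓ c) (block Λ ℓ c') ≤ D with hT
  have h1 : (T.biUnion fun c' => cube ℓ c'.1).card = T.card * ℓ ^ d := by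
    rw [Finset.card_biUnion]
    · simp [card_cube]
    · exact fun a _ a' _ h => hC.1 a.2 a'.2 fun e => h (Subtype.ext e)
  rw [← h1]
  have h2 : (T.biUnion fun c' => cube ℓ c'.1) ⊆
      Fintype.piFinset fun k => Finset.Ico (c.1 k - D - ℓ) (c.1 k + D + 2 * ℓ) := by
    intro x hx
    obtain ⟨c', hc', hx⟩ := Finset.mem_biUnion.mp hx
    have hc' := (Finset.mem_filter.mp hc').2
    obtain ⟨i, hi, j, hj, hij⟩ := exists_manhattan_eq_setDist (block_nonempty hℓ hC c.2)
      (block_nonempty hℓ hC c'.2)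
    have hi := (Finset.mem_filter.mp hi).2
    have hj := (Finset.mem_filter.mp hj).2
    rw [Fintype.mem_piFinset]
    intro k
    have h3 := natAbs_sub_le_manhattan i.1 j.1 k
    have h4 := Finset.mem_Ico.mp (Fintype.mem_piFinset.mp hi k)
    have h5 := Finset.mem_Ico.mp (Fintype.mem_piFinset.mp hj k)
    have h6 := Finset.mem_Ico.mp (Fintype.mem_piFinset.mp hx k)
    rw [Finset.mem_Ico]
    omega
  refine (Finset.card_le_card h2).trans (le_of_eq ?_)
  rw [Fintype.card_piFinset]
  simp only [Int.card_Ico]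
  rw [Finset.prod_congr rfl (g := fun _ => 2 * D + 3 * ℓ) fun k _ => by omega]
  simp

theorem card_near_cubes_le {ℓ : ℕ} (hℓ : 1 ≤ ℓ) {C : Finset (Fin d → ℤ)}
    (hC : IsCubePartition Λ ℓ C) (c : C) (D : ℕ) :
    (Finset.univ.filter fun c' : C => setDist (block Λ ℓ c) (block Λ ℓ c') ≤ D).card ≤
      ⌊(3 * (1 + (D : ℝ) / ℓ)) ^ d⌋₊ := by
  refine Nat.le_floor ?_
  have h := card_near_cubes_mul_le hℓ hC c D
  have hℓ' : (0 : ℝ) < ℓ := by exact_mod_cast hℓ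
  have h' : ((Finset.univ.filter fun c' : C =>
      setDist (block Λ ℓ c) (block Λ ℓ c') ≤ D).card : ℝ) * (ℓ : ℝ) ^ d ≤
      (2 * D + 3 * ℓ) ^ d := by exact_mod_cast h
  rw [← le_div_iff₀ (by positivity), ← div_pow] at h'
  refine h'.trans (pow_le_pow_left₀ (by positivity) ?_ d)
  rw [div_le_iff₀ hℓ']
  have : 3 * (1 + (D : ℝ) / ℓ) * ℓ = 3 * ℓ + 3 * D := by field_simp
  rw [this]
  have : (0 : ℝ) ≤ D := Nat.cast_nonneg D
  linarith

end Geometry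

section Sums

/-! ### Polynomially weighted exponential sums -/

/-- The value of the geometric series `∑ e^{-D / (2ξ)}`. -/
def geomConst (ξ : ℝ) : ℝ := (1 - Real.exp (-(1 / (2 * ξ))))⁻¹

theorem one_le_geomConst {ξ : ℝ} (hξ : 0 < ξ) : 1 ≤ geomConst ξ := by
  have h1 : Real.exp (-(1 / (2 * ξ))) < 1 := Real.exp_lt_one_iff.mpr (neg_lt_zero.mpr (by positivity))
  have h2 := Real.exp_pos (-(1 / (2 * ξ)))
  exact (one_le_inv₀ (by linarith)).mpr (by linarith)

theorem sum_exp_le_geomConst {ξ : ℝ} (hξ : 0 < ξ) (N : ℕ) :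
    ∑ D ∈ Finset.range N, Real.exp (-(D : ℝ) / (2 * ξ)) ≤ geomConst ξ := by
  have h1 : Real.exp (-(1 / (2 * ξ))) < 1 := Real.exp_lt_one_iff.mpr (neg_lt_zero.mpr (by positivity))
  have h2 := Real.exp_pos (-(1 / (2 * ξ)))
  have e : ∀ D : ℕ, Real.exp (-(D : ℝ) / (2 * ξ)) = Real.exp (-(1 / (2 * ξ))) ^ D := by
    intro D
    rw [← Real.exp_nat_mul]
    congr 1
    ring
  simp only [e]
  unfold geomConst
  rw [← tsum_geometric_of_lt_one h2.le h1]
  exact (summable_geometric_of_lt_one h2.le h1).sum_le_tsum _ fun D _ => by positivity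

/-- Half of the exponential decay absorbs the polynomial, through `1 + t ≤ e^t` with `t = D/(2ξq)`.
The dichotomy in `max 1 (2ξq/ℓ)` is the source of the two regimes of the final bound. -/
theorem pow_mul_exp_le {ξ ℓ : ℝ} (hξ : 0 < ξ) (hℓ : 0 < ℓ) (q D : ℕ) :
    Real.exp (-(D : ℝ) / ξ) * (1 + (D : ℝ) / ℓ) ^ q ≤
      max 1 (2 * ξ * q / ℓ) ^ q * Real.exp (-(D : ℝ) / (2 * ξ)) := by
  set u := max 1 (2 * ξ * q / ℓ) with hu
  have hu1 : 1 ≤ u := le_max_left _ _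
  have key : (1 + (D : ℝ) / ℓ) ^ q ≤ u ^ q * Real.exp ((D : ℝ) / (2 * ξ)) := by
    rcases Nat.eq_zero_or_pos q with rfl | hq
    · simp only [pow_zero, one_mul]
      exact Real.one_le_exp (by positivity)
    · have hq' : (0 : ℝ) < q := by exact_mod_cast hq
      have h1 : 1 + (D : ℝ) / ℓ ≤ u * Real.exp ((D : ℝ) / (2 * ξ) / q) := by
        have h2 : (D : ℝ) / ℓ = (2 * ξ * q / ℓ) * ((D : ℝ) / (2 * ξ) / q) := by
          field_simp
        have h3 : (D : ℝ) / ℓ ≤ u * ((D : ℝ) / (2 * ξ) / q) := by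
          rw [h2]
          exact mul_le_mul_of_nonneg_right (le_max_right _ _) (by positivity)
        have h4 := Real.add_one_le_exp ((D : ℝ) / (2 * ξ) / q)
        nlinarith
      calc (1 + (D : ℝ) / ℓ) ^ q ≤ (u * Real.exp ((D : ℝ) / (2 * ξ) / q)) ^ q :=
            pow_le_pow_left₀ (by positivity) h1 q
        _ = _ := by
            rw [mul_pow, ← Real.exp_nat_mul]
            congr 2
            field_simp
  calc _ ≤ Real.exp (-(D : ℝ) / ξ) * (u ^ q * Real.exp ((D : ℝ) / (2 * ξ))) :=
        mul_le_mul_of_nonneg_left key (Real.exp_pos _).le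
    _ = u ^ q * (Real.exp (-(D : ℝ) / ξ) * Real.exp ((D : ℝ) / (2 * ξ))) := by ring
    _ = _ := by
        rw [← Real.exp_add]
        congr 2
        field_simp
        ring

theorem sum_exp_mul_pow_le {ξ ℓ : ℝ} (hξ : 0 < ξ) (hℓ : 0 < ℓ) (q N : ℕ) :
    ∑ D ∈ Finset.range N, Real.exp (-(D : ℝ) / ξ) * (1 + (D : ℝ) / ℓ) ^ q ≤
      max 1 (2 * ξ * q / ℓ) ^ q * geomConst ξ := by
  refine (Finset.sum_le_sum fun D _ => pow_mul_exp_le hξ hℓ q D).trans ?_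
  rw [← Finset.mul_sum]
  exact mul_le_mul_of_nonneg_left (sum_exp_le_geomConst hξ N) (by positivity)

theorem sum_exp_manhattan_le {d : ℕ} {Λ : Finset (Fin d → ℤ)} {ξ : ℝ} (hξ : 0 < ξ) (i : Λ) :
    ∑ j : Λ, Real.exp (-(manhattan i.1 j.1 : ℝ) / ξ) ≤
      2 ^ d * (max 1 (2 * ξ * d) ^ d * geomConst ξ) := by
  set N : ℕ := (Finset.univ.sup fun j : Λ => manhattan i.1 j.1) + 1 with hN
  calc ∑ j : Λ, Real.exp (-(manhattan i.1 j.1 : ℝ) / ξ)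
      = ∑ D ∈ Finset.range N, ∑ j : Λ with manhattan i.1 j.1 = D,
          Real.exp (-(manhattan i.1 j.1 : ℝ) / ξ) := by
        refine (Finset.sum_fiberwise_of_maps_to (fun j _ => ?_) _).symm
        rw [Finset.mem_range, hN, Nat.lt_succ_iff]
        exact Finset.le_sup (f := fun j : Λ => manhattan i.1 j.1) (Finset.mem_univ j)
    _ ≤ ∑ D ∈ Finset.range N, 2 ^ d * (Real.exp (-(D : ℝ) / ξ) * (1 + (D : ℝ) / 1) ^ d) := by
        refine Finset.sum_le_sum fun D _ => ?_
        rw [Finset.sum_congr rfl (g := fun _ => Real.exp (-(D : ℝ) / ξ))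
          fun j hj => by rw [(Finset.mem_filter.mp hj).2], Finset.sum_const, nsmul_eq_mul]
        have h : (Finset.univ.filter fun j : Λ => manhattan i.1 j.1 = D).card ≤ (2 * D + 1) ^ d :=
          (Finset.card_le_card (Finset.monotone_filter_right _ fun _ _ h => h.le)).trans
            (card_sites_le i D)
        have h' : ((Finset.univ.filter fun j : Λ => manhattan i.1 j.1 = D).card : ℝ) ≤
            (2 * D + 1) ^ d := by exact_mod_cast h
        have h2 : (2 * (D : ℝ) + 1) ^ d ≤ 2 ^ d * (1 + (D : ℝ) / 1) ^ d := by
          rw [← mul_pow]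
          exact pow_le_pow_left₀ (by positivity) (by linarith) d
        calc _ ≤ (2 ^ d * (1 + (D : ℝ) / 1) ^ d) * Real.exp (-(D : ℝ) / ξ) :=
              mul_le_mul_of_nonneg_right (h'.trans h2) (Real.exp_pos _).le
          _ = _ := by ring
    _ ≤ _ := by
        rw [← Finset.mul_sum]
        refine mul_le_mul_of_nonneg_left ?_ (by positivity)
        simpa using sum_exp_mul_pow_le hξ one_pos d N

end Sums

section Clustering

/-! ### Consequences of clustering -/

variable {d : ℕ} {Λ : Finset (Fin d → ℤ)}

/-- Removes the threshold `r`: at smaller distances the trivial bound `2‖A‖‖B‖` suffices, since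
`e^{|r|/ξ} e^{-D/ξ} ≥ 1` there. -/
theorem Clustering.norm_cov_le {r ξ : ℝ} (hξ : 0 < ξ) {H : Op Λ} (hH : H.IsHermitian) {β : ℝ}
    (hc : Clustering r ξ (canonical H β)) {X Y : Finset Λ} (hX : X.Nonempty) (hY : Y.Nonempty)
    {A B : Op Λ} (hA : SupportedOn X A) (hB : SupportedOn Y B) {D : ℕ} (hD : D ≤ setDist X Y) :
    ‖(canonical H β * (A * B)).trace - (canonical H β * A).trace * (canonical H β * B).trace‖ ≤
      2 * Real.exp (|r| / ξ) * (opNorm A * opNorm B) * Real.exp (-(D : ℝ) / ξ) := by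
  have hAB : 0 ≤ opNorm A * opNorm B := mul_nonneg (opNorm_nonneg _) (opNorm_nonneg _)
  have hD' : (D : ℝ) ≤ setDist X Y := by exact_mod_cast hD
  have he : 1 ≤ Real.exp (|r| / ξ) := Real.one_le_exp (by positivity)
  by_cases hr : r ≤ setDist X Y
  · have h := hc X Y hX hY hr A B hA hB
    rw [Matrix.mul_assoc] at h
    refine h.trans ?_
    have h1 : Real.exp (-(setDist X Y : ℝ) / ξ) ≤ Real.exp (-(D : ℝ) / ξ) := by
      gcongr
    calc _ ≤ opNorm A * opNorm B * Real.exp (-(D : ℝ) / ξ) := by gcongr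
      _ ≤ (2 * Real.exp (|r| / ξ)) * (opNorm A * opNorm B) * Real.exp (-(D : ℝ) / ξ) := by
        refine mul_le_mul_of_nonneg_right ?_ (Real.exp_pos _).le
        exact le_mul_of_one_le_left hAB (by linarith)
  · have hb : ∀ Z : Op Λ, ‖(canonical H β * Z).trace‖ ≤ opNorm Z := by
      intro Z
      rw [canonical_eq_specFun hH]
      have := norm_trace_specFun_mul_le hH (gibbs hH β) (gibbs_nonneg hH β) Z
      rwa [sum_gibbs, one_mul] at this
    have h1 : 1 ≤ Real.exp (|r| / ξ) * Real.exp (-(D : ℝ) / ξ) := by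
      rw [← Real.exp_add]
      refine Real.one_le_exp ?_
      rw [← add_div]
      refine div_nonneg ?_ hξ.le
      have := le_abs_self r
      linarith
    calc _ ≤ ‖(canonical H β * (A * B)).trace‖ +
          ‖(canonical H β * A).trace * (canonical H β * B).trace‖ := norm_sub_le _ _
      _ ≤ opNorm A * opNorm B + opNorm A * opNorm B := by
          refine add_le_add ((hb _).trans (opNorm_mul_le _ _)) ?_
          rw [norm_mul]
          exact mul_le_mul (hb _) (hb _) (norm_nonneg _) (opNorm_nonneg _)
      _ = 2 * (opNorm A * opNorm B) * 1 := by ring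
      _ ≤ 2 * (opNorm A * opNorm B) * (Real.exp (|r| / ξ) * Real.exp (-(D : ℝ) / ξ)) := by
          gcongr
      _ = _ := by ring

/-- The constant in the bound of the energy variance. -/
def varConst (d ℓ₀ : ℕ) (r ξ : ℝ) : ℝ :=
  2 * Real.exp (|r| / ξ) * Real.exp (2 * ℓ₀ / ξ) * (2 ^ d * (max 1 (2 * ξ * d) ^ d * geomConst ξ))

theorem varConst_pos (d ℓ₀ : ℕ) (r : ℝ) {ξ : ℝ} (hξ : 0 < ξ) : 0 < varConst d ℓ₀ r ξ := by
  have := one_le_geomConst hξ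
  unfold varConst
  positivity

/-- With `e` the mean energy, the variance is the double sum of covariances of local terms. These
decay with distance, so each site contributes a constant. -/
theorem energy_variance_le {ℓ₀ : ℕ} (S : LocalSystem d ℓ₀) {r ξ β : ℝ} (hξ : 0 < ξ)
    (hc : Clustering r ξ (canonical S.ham β)) :
    ∃ e : ℝ, ∑ m, gibbs S.isHermitian_ham β m * (S.isHermitian_ham.eigenvalues m - e) ^ 2 ≤
      varConst d ℓ₀ r ξ * S.n := by
  set hH := S.isHermitian_ham
  set ρ := canonical S.ham β with hρ
  set e : ℝ := ∑ m, gibbs hH β m * hH.eigenvalues m with he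
  refine ⟨e, ?_⟩
  have hρs : ρ = specFun hH (gibbs hH β) := canonical_eq_specFun hH β
  have h1 : (ρ * S.ham).trace = (e : ℂ) := by
    have h := specFun_mul hH (gibbs hH β) hH.eigenvalues
    rw [specFun_eigenvalues] at h
    rw [hρs, h, trace_specFun]
  have h2 : (ρ * (S.ham * S.ham)).trace =
      ((∑ m, gibbs hH β m * hH.eigenvalues m ^ 2 : ℝ) : ℂ) := by
    have h := specFun_mul hH (gibbs hH β) (fun m => hH.eigenvalues m * hH.eigenvalues m)
    rw [← specFun_mul hH hH.eigenvalues hH.eigenvalues, specFun_eigenvalues] at h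
    rw [hρs, h, trace_specFun]
    simp only [pow_two]
  have h3 : ∑ m, gibbs hH β m * (hH.eigenvalues m - e) ^ 2 =
      ∑ m, gibbs hH β m * hH.eigenvalues m ^ 2 - e * e := by
    have : ∀ m, gibbs hH β m * (hH.eigenvalues m - e) ^ 2 =
        gibbs hH β m * hH.eigenvalues m ^ 2 - 2 * e * (gibbs hH β m * hH.eigenvalues m) +
          e ^ 2 * gibbs hH β m := fun m => by ring
    simp only [this]
    rw [Finset.sum_add_distrib, Finset.sum_sub_distrib, ← Finset.mul_sum, ← Finset.mul_sum,
      sum_gibbs, ← he]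
    ring
  have h4 : (ρ * (S.ham * S.ham)).trace - (ρ * S.ham).trace * (ρ * S.ham).trace =
      ∑ i, ∑ j, ((ρ * (S.term i * S.term j)).trace -
        (ρ * S.term i).trace * (ρ * S.term j).trace) := by
    simp only [Finset.sum_sub_distrib]
    congr 1
    · rw [LocalSystem.ham, Finset.sum_mul_sum]
      simp only [Finset.mul_sum, Matrix.trace_sum]
    · rw [LocalSystem.ham, Finset.mul_sum, Matrix.trace_sum, Finset.sum_mul_sum]
  have h5 : ‖(ρ * (S.ham * S.ham)).trace - (ρ * S.ham).trace * (ρ * S.ham).trace‖ ≤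
      ∑ i : S.Λ, ∑ j : S.Λ, 2 * Real.exp (|r| / ξ) * Real.exp (2 * ℓ₀ / ξ) *
        Real.exp (-(manhattan i.1 j.1 : ℝ) / ξ) := by
    rw [h4]
    refine norm_sum_le_of_le _ fun i _ => norm_sum_le_of_le _ fun j _ => ?_
    have hself : ∀ i : S.Λ, i ∈ ballAt ℓ₀ i := fun i => by simp [ballAt, manhattan_self]
    -- The supports come closer than `i` and `j` by at most `2ℓ₀`. The subtraction truncates at
    -- zero, where the bound is trivial; the loss is the factor `e^{2ℓ₀/ξ}`.
    have hd : manhattan i.1 j.1 - 2 * ℓ₀ ≤ setDist (ballAt ℓ₀ i) (ballAt ℓ₀ j) := by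
      obtain ⟨x, hx, y, hy, hxy⟩ := exists_manhattan_eq_setDist ⟨i, hself i⟩ ⟨j, hself j⟩
      have hx := (Finset.mem_filter.mp hx).2
      have hy := (Finset.mem_filter.mp hy).2
      have t1 := manhattan_triangle i.1 x.1 j.1
      have t2 := manhattan_triangle x.1 y.1 j.1
      rw [manhattan_comm y.1 j.1] at t2
      omega
    refine (hc.norm_cov_le hξ hH ⟨i, hself i⟩ ⟨j, hself j⟩ (S.supported_term i)
      (S.supported_term j) hd).trans ?_
    have hn : opNorm (S.term i) * opNorm (S.term j) ≤ 1 :=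
      mul_le_one₀ (S.norm_term_le i) (opNorm_nonneg _) (S.norm_term_le j)
    have hm : (manhattan i.1 j.1 : ℝ) - 2 * ℓ₀ ≤ ((manhattan i.1 j.1 - 2 * ℓ₀ : ℕ) : ℝ) := by
      have : manhattan i.1 j.1 ≤ (manhattan i.1 j.1 - 2 * ℓ₀) + 2 * ℓ₀ := by omega
      have : (manhattan i.1 j.1 : ℝ) ≤ ((manhattan i.1 j.1 - 2 * ℓ₀ : ℕ) : ℝ) + 2 * ℓ₀ := by
        exact_mod_cast this
      linarith
    calc _ ≤ 2 * Real.exp (|r| / ξ) * 1 *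
          (Real.exp (2 * ℓ₀ / ξ) * Real.exp (-(manhattan i.1 j.1 : ℝ) / ξ)) := by
          rw [← Real.exp_add, ← add_div]
          gcongr
          linarith
      _ = _ := by ring
  rw [h3]
  have h6 : ((∑ m, gibbs hH β m * hH.eigenvalues m ^ 2 - e * e : ℝ) : ℂ) =
      (ρ * (S.ham * S.ham)).trace - (ρ * S.ham).trace * (ρ * S.ham).trace := by
    rw [h1, h2]; push_cast; rfl
  rw [← h6, Complex.norm_real] at h5
  refine (le_abs_self _).trans (h5.trans ?_)
  calc _ ≤ ∑ i : S.Λ, varConst d ℓ₀ r ξ := by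
        refine Finset.sum_le_sum fun i _ => ?_
        rw [← Finset.mul_sum]
        exact mul_le_mul_of_nonneg_left (sum_exp_manhattan_le hξ i) (by positivity)
    _ = _ := by
        rw [Finset.sum_const, Finset.card_univ, Fintype.card_coe, nsmul_eq_mul, mul_comm]
        rfl

end Clustering

section Partition

/-! ### The partition function and the number of states in the shell -/

variable {V : Type} [Fintype V] [DecidableEq V] {H : Op V} (hH : H.IsHermitian) {β Δ E : ℝ}

/-- As `βδ ≤ 1`, the Boltzmann factor varies by at most `e` inside the bin; as `δ ≤ Δ`, the bin lies
in the shell below `x`, to which the maximality of `E` applies. -/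
theorem sum_bin_le (hβ : 0 ≤ β) (hE : IsShellEnergy hH β Δ E) {δ : ℝ} (hδΔ : δ ≤ Δ)
    (hβδ : β * δ ≤ 1) (x : ℝ) :
    ∑ m with hH.eigenvalues m ∈ Set.Ioc (x - δ) x, Real.exp (-β * hH.eigenvalues m) ≤
      Real.exp 1 * (Real.exp (-β * E) * shellCount hH E Δ) := by
  have h1 : ∀ m ∈ Finset.univ.filter fun m => hH.eigenvalues m ∈ Set.Ioc (x - δ) x,
      Real.exp (-β * hH.eigenvalues m) ≤ Real.exp 1 * Real.exp (-β * x) := by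
    intro m hm
    have hm := (Finset.mem_filter.mp hm).2.1
    rw [← Real.exp_add]
    refine Real.exp_le_exp.mpr ?_
    nlinarith
  have h2 : (Finset.univ.filter fun m => hH.eigenvalues m ∈ Set.Ioc (x - δ) x).card ≤
      shellCount hH x Δ :=
    Finset.card_le_card (Finset.monotone_filter_right _ fun m _ hm =>
      ⟨by linarith [hm.1], hm.2⟩)
  have h2' : ((Finset.univ.filter fun m => hH.eigenvalues m ∈ Set.Ioc (x - δ) x).card : ℝ) ≤
      shellCount hH x Δ := by exact_mod_cast h2
  refine (Finset.sum_le_card_nsmul _ _ _ h1).trans ?_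
  rw [nsmul_eq_mul]
  calc _ ≤ (shellCount hH x Δ : ℝ) * (Real.exp 1 * Real.exp (-β * x)) :=
        mul_le_mul_of_nonneg_right h2' (by positivity)
    _ = Real.exp 1 * (Real.exp (-β * x) * shellCount hH x Δ) := by ring
    _ ≤ _ := mul_le_mul_of_nonneg_left (hE x) (Real.exp_pos _).le

theorem sum_bins_le (hβ : 0 ≤ β) (hE : IsShellEnergy hH β Δ E) {δ : ℝ} (hδΔ : δ ≤ Δ)
    (hβδ : β * δ ≤ 1) (a : ℝ) (j : ℕ) :
    ∑ m with hH.eigenvalues m ∈ Set.Ioc a (a + j * δ), Real.exp (-β * hH.eigenvalues m) ≤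
      j * (Real.exp 1 * (Real.exp (-β * E) * shellCount hH E Δ)) := by
  induction j with
  | zero => simp
  | succ j ih =>
    have hsub : (Finset.univ.filter fun m =>
        hH.eigenvalues m ∈ Set.Ioc a (a + (j + 1 : ℕ) * δ)) ⊆
        (Finset.univ.filter fun m => hH.eigenvalues m ∈ Set.Ioc a (a + j * δ)) ∪
        Finset.univ.filter fun m => hH.eigenvalues m ∈
          Set.Ioc (a + (j + 1 : ℕ) * δ - δ) (a + (j + 1 : ℕ) * δ) := by
      intro m hm
      have hm := (Finset.mem_filter.mp hm).2
      simp only [Finset.mem_union, Finset.mem_filter, Finset.mem_univ, true_and]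
      rcases le_or_gt (hH.eigenvalues m) (a + j * δ) with h | h
      · exact Or.inl ⟨hm.1, h⟩
      · refine Or.inr ⟨?_, hm.2⟩
        push_cast
        linarith
    refine (Finset.sum_le_sum_of_subset_of_nonneg hsub fun _ _ _ => (Real.exp_pos _).le).trans ?_
    have hu := Finset.sum_union_inter (f := fun m => Real.exp (-β * hH.eigenvalues m))
      (s₁ := Finset.univ.filter fun m => hH.eigenvalues m ∈ Set.Ioc a (a + j * δ))
      (s₂ := Finset.univ.filter fun m => hH.eigenvalues m ∈
          Set.Ioc (a + (j + 1 : ℕ) * δ - δ) (a + (j + 1 : ℕ) * δ))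
    have hi : 0 ≤ ∑ m ∈ (Finset.univ.filter fun m => hH.eigenvalues m ∈ Set.Ioc a (a + j * δ)) ∩
        (Finset.univ.filter fun m => hH.eigenvalues m ∈
          Set.Ioc (a + (j + 1 : ℕ) * δ - δ) (a + (j + 1 : ℕ) * δ)),
        Real.exp (-β * hH.eigenvalues m) := Finset.sum_nonneg fun _ _ => (Real.exp_pos _).le
    have hb := sum_bin_le hH hβ hE hδΔ hβδ (a + (j + 1 : ℕ) * δ)
    have : ((j + 1 : ℕ) : ℝ) * (Real.exp 1 * (Real.exp (-β * E) * shellCount hH E Δ)) =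
      j * (Real.exp 1 * (Real.exp (-β * E) * shellCount hH E Δ)) +
        Real.exp 1 * (Real.exp (-β * E) * shellCount hH E Δ) := by push_cast; ring
    linarith

theorem sum_window_le (hβ : 0 ≤ β) (hE : IsShellEnergy hH β Δ E) {δ : ℝ} (hδ : 0 < δ)
    (hδΔ : δ ≤ Δ) (hβδ : β * δ ≤ 1) (a : ℝ) {w : ℝ} (hw : 0 ≤ w) :
    ∑ m with hH.eigenvalues m ∈ Set.Icc a (a + w), Real.exp (-β * hH.eigenvalues m) ≤
      (w / δ + 2) * (Real.exp 1 * (Real.exp (-β * E) * shellCount hH E Δ)) := by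
  have hc : w / δ ≤ ⌈w / δ⌉₊ := Nat.le_ceil _
  have hc' : (⌈w / δ⌉₊ : ℝ) < w / δ + 1 := Nat.ceil_lt_add_one (by positivity)
  have hwδ : w ≤ ⌈w / δ⌉₊ * δ := by rwa [div_le_iff₀ hδ] at hc
  -- The half-open bins start at `a - δ` in order to catch the closed endpoint `a`. This extra bin
  -- and the rounding up of `w / δ` account for the `+ 2`.
  have hsub : (Finset.univ.filter fun m => hH.eigenvalues m ∈ Set.Icc a (a + w)) ⊆
      Finset.univ.filter fun m =>
        hH.eigenvalues m ∈ Set.Ioc (a - δ) (a - δ + (⌈w / δ⌉₊ + 1 : ℕ) * δ) := by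
    refine Finset.monotone_filter_right _ fun m _ hm => ⟨by linarith [hm.1], ?_⟩
    push_cast
    linarith [hm.2]
  refine (Finset.sum_le_sum_of_subset_of_nonneg hsub fun _ _ _ => (Real.exp_pos _).le).trans
    ((sum_bins_le hH hβ hE hδΔ hβδ _ _).trans ?_)
  refine mul_le_mul_of_nonneg_right ?_ (by positivity)
  push_cast
  linarith

theorem partitionFn_le_of_variance (hβ : 0 ≤ β) (hE : IsShellEnergy hH β Δ E) (hΔ : 0 < Δ)
    {v e : ℝ} (hv : 0 < v)
    (hvar : ∑ m, gibbs hH β m * (hH.eigenvalues m - e) ^ 2 ≤ v) :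
    partitionFn hH β ≤ 2 * (2 * √(2 * v) * (1 + β * Δ) / Δ + 2) *
      (Real.exp 1 * (Real.exp (-β * E) * shellCount hH E Δ)) := by
  -- With this half-width, Chebyshev leaves at most half of the Gibbs weight outside the window.
  set w := √(2 * v) with hw
  have hw0 : 0 < w := Real.sqrt_pos.mpr (by linarith)
  have hw2 : w ^ 2 = 2 * v := Real.sq_sqrt (by linarith)
  have hβΔ : 0 ≤ β * Δ := mul_nonneg hβ hΔ.le
  -- This choice meets both `δ ≤ Δ` and `βδ ≤ 1`, also for `β = 0`.
  set δ := Δ / (1 + β * Δ) with hδ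
  have hδ0 : 0 < δ := by positivity
  have hδΔ : δ ≤ Δ := div_le_self hΔ.le (by linarith)
  have hβδ : β * δ ≤ 1 := by
    rw [hδ, ← mul_div_assoc, div_le_one (by positivity)]
    linarith
  have hwin := sum_window_le hH hβ hE hδ0 hδΔ hβδ (e - w) (w := 2 * w) (by positivity)
  have hZ := partitionFn_pos hH β
  have hg : ∀ m, Real.exp (-β * hH.eigenvalues m) = partitionFn hH β * gibbs hH β m := fun m => by
    unfold gibbs; field_simp
  have htail : ∑ m with ¬ hH.eigenvalues m ∈ Set.Icc (e - w) (e - w + 2 * w), gibbs hH β m ≤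
      1 / 2 := by
    have h1 : ∑ m with ¬ hH.eigenvalues m ∈ Set.Icc (e - w) (e - w + 2 * w),
        2 * v * gibbs hH β m ≤ v := by
      refine (Finset.sum_le_sum (g := fun m => gibbs hH β m * (hH.eigenvalues m - e) ^ 2)
        fun m hm => ?_).trans ((Finset.sum_le_sum_of_subset_of_nonneg (Finset.subset_univ _)
          fun m _ _ => mul_nonneg (gibbs_nonneg hH β m) (sq_nonneg _)).trans hvar)
      have hm := (Finset.mem_filter.mp hm).2
      rw [mul_comm, ← hw2]
      refine mul_le_mul_of_nonneg_left ?_ (gibbs_nonneg hH β m)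
      rw [Set.mem_Icc, not_and_or, not_le, not_le] at hm
      rcases hm with hm | hm <;> nlinarith
    rw [← Finset.mul_sum] at h1
    have : v * (2 * ∑ m with ¬ hH.eigenvalues m ∈ Set.Icc (e - w) (e - w + 2 * w), gibbs hH β m) ≤
        v * 1 := by linarith
    have := le_of_mul_le_mul_left this hv
    linarith
  have hsplit := Finset.sum_filter_add_sum_filter_not Finset.univ
    (fun m => hH.eigenvalues m ∈ Set.Icc (e - w) (e - w + 2 * w)) (gibbs hH β)
  rw [sum_gibbs] at hsplit
  have hin : 1 / 2 ≤ ∑ m with hH.eigenvalues m ∈ Set.Icc (e - w) (e - w + 2 * w),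
      gibbs hH β m := by linarith
  have hlow : partitionFn hH β * (1 / 2) ≤
      ∑ m with hH.eigenvalues m ∈ Set.Icc (e - w) (e - w + 2 * w),
        Real.exp (-β * hH.eigenvalues m) := by
    simp only [hg]
    rw [← Finset.mul_sum]
    exact mul_le_mul_of_nonneg_left hin hZ.le
  have hwδ : 2 * w / δ = 2 * w * (1 + β * Δ) / Δ := by
    rw [hδ]; field_simp
  rw [hwδ] at hwin
  nlinarith

/-- Levels more than `n/β` above the ground energy weigh together at most `2^n e^{-n} ≤ 1` times the
ground state, and the window below them has length at most `2n` bins. No clustering is needed. -/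
theorem partitionFn_le_of_large (hE : IsShellEnergy hH β Δ E) (hΔ : 0 < Δ)
    (hβΔ : 1 ≤ β * Δ) :
    partitionFn hH β ≤ (1 + Real.exp 1 * (2 * Fintype.card V + 2)) *
      (Real.exp (-β * E) * shellCount hH E Δ) := by
  have hβ : 0 < β := by
    by_contra h
    nlinarith
  set n : ℕ := Fintype.card V with hn
  set Q := Real.exp (-β * E) * shellCount hH E Δ with hQ
  obtain ⟨m₀, hm₀⟩ := Finite.exists_min hH.eigenvalues
  set e := hH.eigenvalues m₀ with he
  have hQe : Real.exp (-β * e) ≤ Q := by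
    refine le_trans ?_ (hE e)
    refine le_mul_of_one_le_right (Real.exp_pos _).le ?_
    have : 0 < shellCount hH e Δ := Finset.card_pos.mpr
      ⟨m₀, Finset.mem_filter.mpr ⟨Finset.mem_univ _, by linarith, le_rfl⟩⟩
    exact_mod_cast this
  set δ := Δ / (1 + β * Δ) with hδ
  have hδ0 : 0 < δ := by positivity
  have hδΔ : δ ≤ Δ := div_le_self hΔ.le (by linarith)
  have hβδ : β * δ ≤ 1 := by
    rw [hδ, ← mul_div_assoc, div_le_one (by positivity)]
    linarith
  have hwin := sum_window_le hH hβ.le hE hδ0 hδΔ hβδ e (w := n / β) (by positivity)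
  have hwδ : (n : ℝ) / β / δ ≤ 2 * n := by
    have h1 : (n : ℝ) / β / δ = n * ((1 + β * Δ) / (β * Δ)) := by
      rw [hδ]; field_simp
    have h2 : (1 + β * Δ) / (β * Δ) ≤ 2 := by
      rw [div_le_iff₀ (by linarith)]; linarith
    rw [h1, mul_comm 2]
    exact mul_le_mul_of_nonneg_left h2 (Nat.cast_nonneg n)
  have htail : ∑ m with ¬ hH.eigenvalues m ∈ Set.Icc e (e + n / β),
      Real.exp (-β * hH.eigenvalues m) ≤ Q := by
    refine le_trans ?_ hQe
    refine (Finset.sum_le_card_nsmul _ _ (Real.exp (-β * e) * Real.exp (-n)) ?_).trans ?_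
    · intro m hm
      have hm := (Finset.mem_filter.mp hm).2
      rw [Set.mem_Icc, not_and_or, not_le, not_le] at hm
      rcases hm with hm | hm
      · exact absurd (hm₀ m) (not_le.mpr hm)
      · rw [← Real.exp_add]
        refine Real.exp_le_exp.mpr ?_
        have : β * (e + n / β) = β * e + n := by field_simp
        nlinarith
    · rw [nsmul_eq_mul]
      have h1 : ((Finset.univ.filter fun m =>
          ¬ hH.eigenvalues m ∈ Set.Icc e (e + n / β)).card : ℝ) ≤ 2 ^ n := by
        have : (Finset.univ.filter fun m =>
          ¬ hH.eigenvalues m ∈ Set.Icc e (e + n / β)).card ≤ 2 ^ n := by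
          refine (Finset.card_le_univ _).trans (le_of_eq ?_)
          rw [Fintype.card_fun, Fintype.card_fin]
        exact_mod_cast this
      have h2 : (2 : ℝ) ^ n ≤ Real.exp n := by
        have h3 : (2 : ℝ) ≤ Real.exp 1 := by linarith [Real.add_one_le_exp (1 : ℝ)]
        calc (2 : ℝ) ^ n ≤ Real.exp 1 ^ n := pow_le_pow_left₀ (by norm_num) h3 n
          _ = _ := by rw [← Real.exp_nat_mul, mul_one]
      calc _ ≤ Real.exp n * (Real.exp (-β * e) * Real.exp (-n)) :=
            mul_le_mul_of_nonneg_right (h1.trans h2) (by positivity)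
        _ = Real.exp (-β * e) * (Real.exp n * Real.exp (-n)) := by ring
        _ = _ := by rw [← Real.exp_add]; simp
  have hsplit := Finset.sum_filter_add_sum_filter_not Finset.univ
    (fun m => hH.eigenvalues m ∈ Set.Icc e (e + n / β))
    (fun m => Real.exp (-β * hH.eigenvalues m))
  have hQ0 : 0 ≤ Real.exp 1 * Q := by positivity
  have : ((n : ℝ) / β / δ + 2) * (Real.exp 1 * Q) ≤ (2 * n + 2) * (Real.exp 1 * Q) :=
    mul_le_mul_of_nonneg_right (by linarith) hQ0
  change ∑ m, Real.exp (-β * hH.eigenvalues m) ≤ _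
  rw [← hsplit]
  linarith

theorem shellCount_pos (hE : IsShellEnergy hH β Δ E) (hΔ : 0 < Δ) : 0 < shellCount hH E Δ := by
  obtain ⟨m₀⟩ : Nonempty (Config V) := inferInstance
  have h1 : 0 < shellCount hH (hH.eigenvalues m₀) Δ := Finset.card_pos.mpr
    ⟨m₀, Finset.mem_filter.mpr ⟨Finset.mem_univ _, by linarith, le_rfl⟩⟩
  have h2 := hE (hH.eigenvalues m₀)
  have h3 : 0 < Real.exp (-β * hH.eigenvalues m₀) * shellCount hH (hH.eigenvalues m₀) Δ := by
    positivity
  have h4 := h3.trans_le h2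
  exact_mod_cast pos_of_mul_pos_right h4 (Real.exp_pos _).le

/-- A level in the shell has `E_m ≤ E`, so its Gibbs weight is at least `e^{-βE}/Z`. This yields the
operator inequality `ρ_{E,Δ} ≤ M ρ_β`. -/
theorem shellWeight_le (hβ : 0 ≤ β) {M : ℝ} (hN : 0 < shellCount hH E Δ)
    (hZ : partitionFn hH β ≤ M * (Real.exp (-β * E) * shellCount hH E Δ)) (m : Config V) :
    shellWeight hH E Δ m ≤ M * gibbs hH β m := by
  have hZ0 := partitionFn_pos hH β
  have hN' : (0 : ℝ) < shellCount hH E Δ := by exact_mod_cast hN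
  have hM : 0 < M := by
    by_contra h
    have : M * (Real.exp (-β * E) * shellCount hH E Δ) ≤ 0 :=
      mul_nonpos_of_nonpos_of_nonneg (not_lt.mp h) (by positivity)
    linarith
  unfold shellWeight
  split_ifs with hm
  · have hm := (Finset.mem_filter.mp hm).2.2
    have h1 : Real.exp (-β * E) ≤ Real.exp (-β * hH.eigenvalues m) :=
      Real.exp_le_exp.mpr (by nlinarith)
    unfold gibbs
    rw [mul_one, inv_eq_one_div, div_le_iff₀ hN']
    have h2 : M * ((partitionFn hH β)⁻¹ * Real.exp (-β * hH.eigenvalues m)) * shellCount hH E Δ =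
        (M * (Real.exp (-β * hH.eigenvalues m) * shellCount hH E Δ)) / partitionFn hH β := by
      field_simp
    rw [h2, le_div_iff₀ hZ0, one_mul]
    refine hZ.trans ?_
    gcongr
  · rw [mul_zero]
    exact mul_nonneg hM.le (gibbs_nonneg hH β m)

end Partition

/-! ### Consequences of the condition on `κ`: the ratio of the ensembles is at most a power of
`√n/Δ`. -/

section Admissible

variable {d ℓ₀ : ℕ} {S : LocalSystem d ℓ₀} {r ξ κ β E Δ : ℝ} {ℓ : ℕ} {C : Finset (Fin d → ℤ)}

theorem LocalSystem.Admissible.n_pos (h : S.Admissible r ξ κ β E Δ ℓ C) : 1 ≤ S.n := by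
  by_contra hn
  -- For `n = 0` both logarithms take the default value `log 0 = 0`, and the condition reads `1 ≤
  -- 0`.
  have hn : S.n = 0 := by omega
  have hβΔ : 0 ≤ β * Δ := mul_nonneg h.beta_nonneg h.width_pos.le
  have := h.width_le
  rw [hn] at this
  simp only [Nat.cast_zero, Real.sqrt_zero, zero_div, Real.log_zero, mul_zero] at this
  rw [min_eq_left (by linarith), Real.log_zero] at this
  linarith

theorem LocalSystem.Admissible.one_le_min (h : S.Admissible r ξ κ β E Δ ℓ C) :
    1 ≤ min (S.n : ℝ) (1 + β * Δ) := by
  have hβΔ : 0 ≤ β * Δ := mul_nonneg h.beta_nonneg h.width_pos.le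
  exact le_min (by exact_mod_cast h.n_pos) (by linarith)

theorem LocalSystem.Admissible.one_le_mul_log (h : S.Admissible r ξ κ β E Δ ℓ C) :
    1 ≤ κ * Real.log (√(S.n : ℝ) / Δ) := by
  have := h.width_le
  have := Real.log_nonneg h.one_le_min
  linarith

theorem LocalSystem.Admissible.log_pos (hκ : 0 < κ) (h : S.Admissible r ξ κ β E Δ ℓ C) :
    0 < Real.log (√(S.n : ℝ) / Δ) := by
  have := h.one_le_mul_log
  exact pos_of_mul_pos_right (by linarith) hκ.le

theorem exists_partitionFn_le (d ℓ₀ : ℕ) (r : ℝ) {ξ κ : ℝ} (hξ : 0 < ξ) (hκ : 0 < κ) :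
    ∃ c > (0 : ℝ), ∀ (S : LocalSystem d ℓ₀) (β E Δ : ℝ) (ℓ : ℕ) (C : Finset (Fin d → ℤ)),
      S.Admissible r ξ κ β E Δ ℓ C →
        partitionFn S.isHermitian_ham β ≤ Real.exp (c * Real.log (√(S.n : ℝ) / Δ)) *
          (Real.exp (-β * E) * shellCount S.isHermitian_ham E Δ) := by
  set A := √(2 * varConst d ℓ₀ r ξ) with hA
  have hA0 : 0 ≤ A := Real.sqrt_nonneg _
  set K := Real.exp 1 * (8 * A + 9) with hK
  have he : 1 ≤ Real.exp 1 := by linarith [Real.add_one_le_exp (1 : ℝ)]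
  have hK1 : 1 ≤ K := by nlinarith
  have hlogK : 0 ≤ Real.log K := Real.log_nonneg hK1
  -- The three summands cover `log K ≤ κ L log K`, `log s = L` and `log μ ≤ κ L`, in the bound `K s
  -- μ` for the ratio.
  refine ⟨κ * Real.log K + 1 + κ, by positivity, ?_⟩
  intro S β E Δ ℓ C h
  set L := Real.log (√(S.n : ℝ) / Δ) with hL
  set s := √(S.n : ℝ) / Δ with hs
  set μ := min (S.n : ℝ) (1 + β * Δ) with hμ
  set Q := Real.exp (-β * E) * shellCount S.isHermitian_ham E Δ with hQ
  have hΔ := h.width_pos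
  have hQ0 : 0 ≤ Q := by positivity
  have hn : (1 : ℝ) ≤ S.n := by exact_mod_cast h.n_pos
  have hβΔ : 0 ≤ β * Δ := mul_nonneg h.beta_nonneg hΔ.le
  have hL0 : 0 < L := h.log_pos hκ
  have hs0 : 0 < s := by positivity
  have hs1 : 1 ≤ s := ((Real.log_pos_iff hs0.le).mp hL0).le
  have hμ1 : 1 ≤ μ := h.one_le_min
  have hsμ : 1 ≤ s * μ := one_le_mul_of_one_le_of_one_le hs1 hμ1
  have main : partitionFn S.isHermitian_ham β ≤ K * (s * μ) * Q := by
    -- Either the variance bound already has the right size, or the minimum `μ` equals `n` and,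
    -- since `μ ≥ 1`, the factor 2 forces `βΔ ≥ 1`, as the count above the ground energy requires.
    by_cases hc : 1 + β * Δ ≤ 2 * μ
    · obtain ⟨e, hvar⟩ := energy_variance_le S hξ h.clustering
      have hv : 0 < varConst d ℓ₀ r ξ * S.n := mul_pos (varConst_pos d ℓ₀ r hξ) (by linarith)
      refine (partitionFn_le_of_variance _ h.beta_nonneg h.energy hΔ hv hvar).trans ?_
      have e1 : √(2 * (varConst d ℓ₀ r ξ * S.n)) = A * √(S.n : ℝ) := by
        rw [hA, ← mul_assoc, Real.sqrt_mul (by have := varConst_pos d ℓ₀ r hξ; positivity)]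
      have e2 : 2 * √(2 * (varConst d ℓ₀ r ξ * S.n)) * (1 + β * Δ) / Δ =
          2 * A * (s * (1 + β * Δ)) := by
        rw [e1, hs]; field_simp
      rw [e2]
      have e3 : s * (1 + β * Δ) ≤ 2 * (s * μ) := by nlinarith
      have e4 : 2 * (2 * A * (s * (1 + β * Δ)) + 2) ≤ (8 * A + 9) * (s * μ) := by nlinarith
      calc _ ≤ ((8 * A + 9) * (s * μ)) * (Real.exp 1 * Q) :=
            mul_le_mul_of_nonneg_right e4 (by positivity)
        _ = _ := by rw [hK]; ring
    · have hμn : μ = S.n := by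
        rcases min_choice (S.n : ℝ) (1 + β * Δ) with h1 | h1
        · exact h1
        · exact absurd (by rw [hμ, h1]; linarith) hc
      have hβ1 : 1 ≤ β * Δ := by
        have : 2 * μ < 1 + β * Δ := not_le.mp hc
        linarith
      refine (partitionFn_le_of_large _ h.energy hΔ hβ1).trans ?_
      refine mul_le_mul_of_nonneg_right ?_ hQ0
      have hcard : (Fintype.card S.Λ : ℝ) = S.n := by
        rw [Fintype.card_coe]; rfl
      rw [hcard, ← hμn]
      have e5 : μ ≤ s * μ := le_mul_of_one_le_left (by linarith) hs1
      have e6 : 1 + Real.exp 1 * (2 * μ + 2) ≤ Real.exp 1 * 9 * (s * μ) := by nlinarith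
      refine e6.trans ?_
      rw [hK]
      refine mul_le_mul_of_nonneg_right ?_ (by linarith)
      nlinarith
  refine main.trans (mul_le_mul_of_nonneg_right ?_ hQ0)
  have hK0 : K ≠ 0 := by linarith
  have hμ0 : μ ≠ 0 := by linarith
  rw [← Real.log_le_iff_le_exp (by positivity), Real.log_mul hK0 (mul_ne_zero hs0.ne' hμ0),
    Real.log_mul hs0.ne' hμ0]
  have h1 := h.one_le_mul_log
  have h2 : 1 + Real.log μ ≤ κ * L := h.width_le
  have h3 : Real.log K ≤ κ * L * Real.log K := le_mul_of_one_le_left hlogK h1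
  change Real.log K + (L + Real.log μ) ≤ _
  linarith

end Admissible

section BlockMoments

/-! ### Moments of a sum of block observables -/

variable {d : ℕ} {Λ : Finset (Fin d → ℤ)}

/-- Lets the product of all factors but the isolated one enter the clustering bound as a single
operator. -/
theorem prod_mem_supportedOn {ι : Type*} {R : Type*} [CommRing R] (f : R →+* Op Λ)
    {y : ι → R} {X : ι → Finset Λ} (hy : ∀ i, SupportedOn (X i) (f (y i)))
    (hn : ∀ i, opNorm (f (y i)) ≤ 2) (s : Finset ι) :
    SupportedOn (s.biUnion X) (f (∏ i ∈ s, y i)) ∧ opNorm (f (∏ i ∈ s, y i)) ≤ 2 ^ s.card := by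
  classical
  induction s using Finset.induction_on with
  | empty =>
    rw [Finset.prod_empty, map_one]
    exact ⟨supportedOn_one _, by simpa using opNorm_one_le⟩
  | insert i s hi ih =>
    rw [Finset.prod_insert hi, map_mul, Finset.biUnion_insert, Finset.card_insert_of_notMem hi]
    refine ⟨((hy i).mono Finset.subset_union_left).mul (ih.1.mono Finset.subset_union_right),
      (opNorm_mul_le _ _).trans ?_⟩
    rw [pow_succ']
    exact mul_le_mul (hn i) ih.2 (opNorm_nonneg _) (by norm_num)

theorem norm_trace_sum_pow_le {r ξ : ℝ} (hξ : 0 < ξ) {H : Op Λ} (hH : H.IsHermitian) {β : ℝ}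
    (hcl : Clustering r ξ (canonical H β)) {ℓ : ℕ} (hℓ : 1 ≤ ℓ) {C : Finset (Fin d → ℤ)}
    (hC : IsCubePartition Λ ℓ C) (x : C → Op Λ) (hx : ∀ c : C, SupportedOn (block Λ ℓ c) (x c))
    (hn : ∀ c, opNorm (x c) ≤ 2) (h0 : ∀ c, (canonical H β * x c).trace = 0) {k : ℕ}
    (hk : 1 ≤ k) :
    ‖(canonical H β * (∑ c, x c) ^ (2 * k)).trace‖ ≤
      2 * Real.exp (|r| / ξ) * 4 ^ k * (4 ^ k * (C.card * k) ^ k *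
        (3 ^ (d * k) * (max 1 (2 * ξ * (d * k : ℕ) / ℓ) ^ (d * k) * geomConst ξ))) := by
  have hcomm : ∀ a ∈ Set.range x, ∀ b ∈ Set.range x, a * b = b * a := by
    rintro _ ⟨c, rfl⟩ _ ⟨c', rfl⟩
    by_cases h : c = c'
    · rw [h]
    · exact SupportedOn.commute (block_disjoint hC c.2 c'.2 fun e => h (Subtype.ext e))
        (hx c) (hx c')
  -- Observables on disjoint blocks commute, so the expansion of the power takes place in the
  -- commutative algebra that they generate.
  let R := Algebra.adjoin ℂ (Set.range x)
  have hR : IsMulCommutative R := Algebra.isMulCommutative_adjoin ℂ hcomm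
  let _ : CommRing R := { R.toRing with mul_comm := hR.is_comm.comm }
  let f : R →+* Op Λ := R.val.toRingHom
  let y : C → R := fun c => ⟨x c, Algebra.subset_adjoin ⟨c, rfl⟩⟩
  let φ : R →+ ℂ := ((Matrix.traceAddMonoidHom (Config Λ) ℂ).comp
    (AddMonoidHom.mulLeft (canonical H β))).comp f.toAddMonoidHom
  have hφ : ∀ z : R, φ z = (canonical H β * f z).trace := fun z => rfl
  have hfy : ∀ c, f (y c) = x c := fun c => rfl
  have hsum : (canonical H β * (∑ c, x c) ^ (2 * k)).trace = φ ((∑ c, y c) ^ (2 * k)) := by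
    rw [hφ, map_pow, map_sum]
    rfl
  rw [hsum]
  have hℓ' : (0 : ℝ) < ℓ := by exact_mod_cast hℓ
  have main := norm_moment_le φ y (fun c c' => setDist (block Λ ℓ c) (block Λ ℓ c'))
    (fun c c' => setDist_comm _ _) hk (b := 2 * Real.exp (|r| / ξ) * 4 ^ k)
    (W := 3 ^ (d * k) * (max 1 (2 * ξ * (d * k : ℕ) / ℓ) ^ (d * k) * geomConst ξ))
    (by positivity) (fun D => Real.exp (-(D : ℝ) / ξ)) (fun D => (Real.exp_pos _).le) ?_
    (fun D => ⌊(3 * (1 + (D : ℝ) / ℓ)) ^ d⌋₊) (fun D c => card_near_cubes_le hℓ hC c D) ?_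
  · rwa [Fintype.card_coe] at main
  · intro t i D hD
    have hnt : Nontrivial (Fin (2 * k)) := Fin.nontrivial_iff_two_le.mpr (by omega)
    obtain ⟨j₀, hj₀⟩ := exists_ne i
    obtain ⟨hs, hb⟩ := prod_mem_supportedOn f (y := fun j => y (t j))
      (X := fun j => block Λ ℓ (t j)) (fun j => hx (t j)) (fun j => hn (t j))
      (Finset.univ.erase i)
    rw [← Finset.mul_prod_erase Finset.univ _ (Finset.mem_univ i), hφ, map_mul, hfy]
    have hne : ((Finset.univ.erase i).biUnion fun j => block Λ ℓ (t j)).Nonempty := by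
      obtain ⟨z, hz⟩ := block_nonempty hℓ hC (t j₀).2
      exact ⟨z, Finset.mem_biUnion.mpr ⟨j₀, Finset.mem_erase.mpr ⟨hj₀, Finset.mem_univ _⟩, hz⟩⟩
    have hdist : D ≤ setDist (block Λ ℓ (t i))
        ((Finset.univ.erase i).biUnion fun j => block Λ ℓ (t j)) := by
      obtain ⟨a, ha, z, hz, e⟩ := exists_manhattan_eq_setDist (block_nonempty hℓ hC (t i).2) hne
      obtain ⟨j, hj, hz⟩ := Finset.mem_biUnion.mp hz
      rw [e]
      exact (hD j (Finset.ne_of_mem_erase hj)).trans (setDist_le ha hz)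
    have h := hcl.norm_cov_le hξ hH (block_nonempty hℓ hC (t i).2) hne (hx (t i)) hs hdist
    -- The isolated factor is centred, so its covariance with the rest is the full expectation
    -- value.
    rw [h0 (t i), zero_mul, sub_zero] at h
    refine h.trans ?_
    have h2 : opNorm (x (t i)) * opNorm (f (∏ j ∈ Finset.univ.erase i, y (t j))) ≤ 4 ^ k := by
      calc _ ≤ 2 * (2 : ℝ) ^ (Finset.univ.erase i).card :=
            mul_le_mul (hn _) hb (opNorm_nonneg _) (by norm_num)
        _ = 2 ^ (2 * k) := by
            rw [← pow_succ', Finset.card_erase_of_mem (Finset.mem_univ i), Finset.card_univ,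
              Fintype.card_fin]
            congr 1
            omega
        _ = 4 ^ k := by rw [pow_mul]; norm_num
    gcongr
  · intro N
    calc _ ≤ ∑ D ∈ Finset.range N, 3 ^ (d * k) *
          (Real.exp (-(D : ℝ) / ξ) * (1 + (D : ℝ) / ℓ) ^ (d * k)) := by
          refine Finset.sum_le_sum fun D _ => ?_
          have h1 : ((⌊(3 * (1 + (D : ℝ) / ℓ)) ^ d⌋₊ : ℕ) : ℝ) ≤ (3 * (1 + (D : ℝ) / ℓ)) ^ d :=
            Nat.floor_le (by positivity)
          calc _ ≤ Real.exp (-(D : ℝ) / ξ) * ((3 * (1 + (D : ℝ) / ℓ)) ^ d) ^ k := by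
                gcongr
            _ = _ := by rw [← pow_mul, mul_pow]; ring
      _ ≤ _ := by
          rw [← Finset.mul_sum]
          exact mul_le_mul_of_nonneg_left (sum_exp_mul_pow_le hξ hℓ' _ N) (by positivity)

/-- Comparison of the two ensembles on all blocks, through a moment of order `2 ^ (j + 1)`. -/
theorem sum_traceNorm_pow_le {r ξ : ℝ} (hξ : 0 < ξ) {H : Op Λ} (hH : H.IsHermitian) {β E Δ : ℝ}
    (hβ : 0 ≤ β) (hcl : Clustering r ξ (canonical H β)) (hΔ : 0 < Δ)
    (hE : IsShellEnergy hH β Δ E) {ℓ : ℕ} (hℓ : 1 ≤ ℓ) {C : Finset (Fin d → ℤ)}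
    (hC : IsCubePartition Λ ℓ C) {M : ℝ}
    (hZ : partitionFn hH β ≤ M * (Real.exp (-β * E) * shellCount hH E Δ)) {j k : ℕ}
    (hk : k = 2 ^ j) :
    (∑ c ∈ C, traceNorm (reduced (block Λ ℓ c) (microcanonical hH E Δ) -
      reduced (block Λ ℓ c) (canonical H β))) ^ (2 * k) ≤
      M * (2 * Real.exp (|r| / ξ) * 4 ^ k * (4 ^ k * (C.card * k) ^ k *
        (3 ^ (d * k) * (max 1 (2 * ξ * (d * k : ℕ) / ℓ) ^ (d * k) * geomConst ξ)))) := by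
  have hk1 : 1 ≤ k := by rw [hk]; exact Nat.one_le_two_pow
  have hN := shellCount_pos hH hE hΔ
  have hβs := canonical_eq_specFun hH β
  have hms := microcanonical_eq_specFun hH E Δ
  have hw := shellWeight_le hH hβ hN hZ
  have hM : 0 ≤ M := by
    by_contra h
    have h1 : M * (Real.exp (-β * E) * shellCount hH E Δ) ≤ 0 :=
      mul_nonpos_of_nonpos_of_nonneg (not_le.mp h).le (by positivity)
    linarith [partitionFn_pos hH β]
  have hX : ∀ c : C, ∃ a : Op (block Λ ℓ c), a.IsHermitian ∧ a * a = 1 ∧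
      (((reduced (block Λ ℓ c) (microcanonical hH E Δ) -
        reduced (block Λ ℓ c) (canonical H β)) * a).trace =
        (traceNorm (reduced (block Λ ℓ c) (microcanonical hH E Δ) -
          reduced (block Λ ℓ c) (canonical H β)) : ℂ)) := by
    intro c
    refine exists_traceNorm_eq ?_
    rw [← reduced_sub]
    refine isHermitian_reduced _ ?_
    rw [hβs, hms]
    exact (isHermitian_specFun _ _).sub (isHermitian_specFun _ _)
  choose a ha1 ha2 ha3 using hX
  set μ : C → ℝ := fun c => (canonical H β * embed (block Λ ℓ c) (a c)).trace.re with hμ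
  have hμ' : ∀ c : C, (canonical H β * embed (block Λ ℓ c) (a c)).trace = (μ c : ℂ) := by
    intro c
    refine Complex.ext rfl ?_
    rw [Complex.ofReal_im, hβs]
    exact trace_specFun_mul_im _ _ (isHermitian_embed (ha1 c))
  have hsq : ∀ c : C, embed (block Λ ℓ c) (a c) * embed (block Λ ℓ c) (a c) = 1 := fun c => by
    rw [← embed_mul, ha2, embed_one]
  have hβ1 : (canonical H β).trace = 1 := by
    rw [hβs, trace_specFun, sum_gibbs, Complex.ofReal_one]
  have hm1 : (microcanonical hH E Δ).trace = 1 := by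
    rw [hms, trace_specFun, sum_shellWeight hH hN, Complex.ofReal_one]
  have hμ1 : ∀ c, |μ c| ≤ 1 := by
    intro c
    have h := sq_trace_specFun_mul_le hH (gibbs hH β) (gibbs_nonneg hH β) (sum_gibbs hH β)
      (isHermitian_embed (ha1 c))
    rw [← hβs, hsq, Matrix.mul_one, hβ1, Complex.one_re] at h
    exact (sq_le_one_iff_abs_le_one _).mp h
  -- Centred in the canonical state, so that the microcanonical expectation is the difference of the
  -- two ensembles, namely the trace norm.
  set x : C → Op Λ := fun c => embed (block Λ ℓ c) (a c) - (μ c : ℂ) • 1 with hx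
  have hxH : ∀ c, (x c).IsHermitian := by
    intro c
    refine (isHermitian_embed (ha1 c)).sub ?_
    unfold Matrix.IsHermitian
    rw [Matrix.conjTranspose_smul, Matrix.conjTranspose_one]
    simp
  have hxs : ∀ c : C, SupportedOn (block Λ ℓ c) (x c) := fun c =>
    ⟨a c - (μ c : ℂ) • 1, by rw [embed_sub, embed_smul, embed_one]⟩
  have hxn : ∀ c, opNorm (x c) ≤ 2 := by
    intro c
    refine (opNorm_sub_le _ _).trans ?_
    have h1 : opNorm (embed (block Λ ℓ c) (a c)) ≤ 1 := by
      refine opNorm_le_one_of_star_mul_self ?_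
      rw [Matrix.star_eq_conjTranspose, (isHermitian_embed (ha1 c)).eq, hsq]
    have h2 : opNorm ((μ c : ℂ) • (1 : Op Λ)) ≤ 1 := by
      rw [opNorm_smul, Complex.norm_real]
      exact mul_le_one₀ (hμ1 c) (opNorm_nonneg _) opNorm_one_le
    linarith
  have hx0 : ∀ c, (canonical H β * x c).trace = 0 := by
    intro c
    simp only [hx, Matrix.mul_sub, Matrix.mul_smul, Matrix.mul_one, Matrix.trace_sub,
      Matrix.trace_smul, hβ1, hμ']
    simp
  have hxm : ∀ c : C, (microcanonical hH E Δ * x c).trace =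
      (traceNorm (reduced (block Λ ℓ c) (microcanonical hH E Δ) -
          reduced (block Λ ℓ c) (canonical H β)) : ℂ) := by
    intro c
    rw [← ha3, Matrix.sub_mul, Matrix.trace_sub, trace_reduced_mul, trace_reduced_mul, hμ']
    simp only [hx, Matrix.mul_sub, Matrix.mul_smul, Matrix.mul_one, Matrix.trace_sub,
      Matrix.trace_smul, hm1]
    simp
  set Y : Op Λ := ∑ c, x c with hY
  have hYH : Y.IsHermitian := by
    unfold Matrix.IsHermitian
    rw [hY, Matrix.conjTranspose_sum]
    exact Finset.sum_congr rfl fun c _ => hxH c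
  have hYm : (microcanonical hH E Δ * Y).trace.re =
      ∑ c ∈ C, traceNorm (reduced (block Λ ℓ c) (microcanonical hH E Δ) -
          reduced (block Λ ℓ c) (canonical H β)) := by
    rw [hY, Finset.mul_sum, Matrix.trace_sum, Complex.re_sum, ← Finset.sum_coe_sort C]
    refine Finset.sum_congr rfl fun c _ => ?_
    rw [hxm, Complex.ofReal_re]
  have hpow := pow_trace_specFun_mul_le hH (shellWeight hH E Δ) (shellWeight_nonneg hH E Δ)
    (sum_shellWeight hH hN) hYH j
  have e2k : 2 ^ (j + 1) = 2 * k := by rw [hk, pow_succ']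
  rw [← hms, hYm, e2k] at hpow
  have hcomp : (microcanonical hH E Δ * Y ^ (2 * k)).trace.re ≤
      M * (canonical H β * Y ^ (2 * k)).trace.re := by
    -- `M ρ_β - ρ_{E,Δ}` has nonnegative weights and `Y ^ (2k)` is the square of `Y ^ k`.
    have h := trace_specFun_mul_sq_nonneg hH (fun m => M * gibbs hH β m - shellWeight hH E Δ m)
      (fun m => sub_nonneg.mpr (hw m)) (hYH.pow k)
    rw [← specFun_sub, ← smul_specFun, ← hβs, ← hms, ← pow_add, ← two_mul, Matrix.sub_mul,
      Matrix.trace_sub, Matrix.smul_mul, Matrix.trace_smul, Complex.sub_re, smul_eq_mul,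
      Complex.re_ofReal_mul] at h
    linarith
  refine hpow.trans (hcomp.trans (mul_le_mul_of_nonneg_left ?_ hM))
  exact (Complex.re_le_norm _).trans
    (norm_trace_sum_pow_le hξ hH hcl hℓ hC x hxs hxn hx0 hk1)

end BlockMoments

/-! ### Choice of the moment order and the explicit estimates. -/

section FinalBounds

theorem exists_two_pow_near {y : ℝ} (hy : 1 ≤ y) : ∃ j : ℕ, y ≤ 2 ^ j ∧ (2 : ℝ) ^ j ≤ 2 * y := by
  obtain ⟨n, h1, h2⟩ := exists_nat_pow_near hy (one_lt_two : (1 : ℝ) < 2)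
  exact ⟨n + 1, h2.le, by rw [pow_succ']; linarith⟩

variable {d ℓ₀ : ℕ} {S : LocalSystem d ℓ₀} {r ξ κ β E Δ : ℝ} {ℓ : ℕ} {C : Finset (Fin d → ℤ)}

theorem LocalSystem.Admissible.card_mul (h : S.Admissible r ξ κ β E Δ ℓ C) :
    (S.n : ℝ) = C.card * (ℓ : ℝ) ^ d := by
  have : S.n = C.card * ℓ ^ d := card_eq_of_partition h.partition
  exact_mod_cast this

theorem LocalSystem.Admissible.card_pos (h : S.Admissible r ξ κ β E Δ ℓ C) :
    (0 : ℝ) < C.card := by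
  have h1 := h.card_mul
  have h2 : (1 : ℝ) ≤ S.n := by exact_mod_cast h.n_pos
  rcases Nat.eq_zero_or_pos C.card with h0 | h0
  · rw [h0, Nat.cast_zero, zero_mul] at h1
    linarith
  · exact_mod_cast h0

/-- The prefactor of `√N` in the bound of the sum over `N` blocks. -/
def blockConst (d : ℕ) (r ξ : ℝ) : ℝ :=
  Real.exp 1 * (2 * Real.exp (|r| / ξ) * geomConst ξ) * 16 * 3 ^ d

theorem blockConst_pos (d : ℕ) (r : ℝ) {ξ : ℝ} (hξ : 0 < ξ) : 0 < blockConst d r ξ := by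
  have := one_le_geomConst hξ
  unfold blockConst
  positivity

theorem LocalSystem.Admissible.sq_sum_traceNorm_le (hξ : 0 < ξ)
    (h : S.Admissible r ξ κ β E Δ ℓ C) {y : ℝ} (hy : 1 ≤ y)
    (hZ : partitionFn S.isHermitian_ham β ≤ Real.exp y *
      (Real.exp (-β * E) * shellCount S.isHermitian_ham E Δ)) :
    (∑ c ∈ C, traceNorm (reduced (block S.Λ ℓ c) (microcanonical S.isHermitian_ham E Δ) -
      reduced (block S.Λ ℓ c) (canonical S.ham β))) ^ 2 ≤
      C.card * (blockConst d r ξ * (2 * y) * max 1 (2 * ξ * d * (2 * y) / ℓ) ^ d) := by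
  obtain ⟨j, hj1, hj2⟩ := exists_two_pow_near hy
  set k : ℕ := 2 ^ j with hk
  have hkr : (k : ℝ) = 2 ^ j := by rw [hk]; push_cast; rfl
  rw [← hkr] at hj1 hj2
  have hk0 : k ≠ 0 := by rw [hk]; positivity
  have hℓ : (0 : ℝ) < ℓ := by exact_mod_cast h.side_pos
  have hg := one_le_geomConst hξ
  have hmain := sum_traceNorm_pow_le hξ S.isHermitian_ham h.beta_nonneg h.clustering h.width_pos
    h.energy h.side_pos h.partition hZ hk
  set T := ∑ c ∈ C, traceNorm (reduced (block S.Λ ℓ c) (microcanonical S.isHermitian_ham E Δ) -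
      reduced (block S.Λ ℓ c) (canonical S.ham β)) with hT
  set B := 2 * Real.exp (|r| / ξ) * geomConst ξ with hB
  set u := max 1 (2 * ξ * (d * k : ℕ) / ℓ) with hu
  have hu1 : 1 ≤ u := le_max_left _ _
  have hB1 : 1 ≤ B := by
    have : 1 ≤ Real.exp (|r| / ξ) := Real.one_le_exp (by positivity)
    nlinarith
  -- All prefactors are dominated by `k`-th powers, `e^y` because `y ≤ k`, so that a `k`-th root can
  -- be taken; `k ≤ 2y` then removes `k` from the result.
  have hBk : B ≤ B ^ k := le_self_pow₀ hB1 hk0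
  have hyk : Real.exp y ≤ Real.exp 1 ^ k := by
    rw [← Real.exp_nat_mul, mul_one]
    exact Real.exp_le_exp.mpr hj1
  have h1 : (T ^ 2) ^ k ≤ (Real.exp 1 * B * 16 * 3 ^ d * (C.card * k) * u ^ d) ^ k := by
    rw [← pow_mul]
    refine hmain.trans ?_
    calc _ = Real.exp y * B * (4 ^ k * 4 ^ k * (C.card * k) ^ k * 3 ^ (d * k) * u ^ (d * k)) := by
          rw [hB]; ring
      _ ≤ Real.exp 1 ^ k * B ^ k *
          (4 ^ k * 4 ^ k * (C.card * k) ^ k * 3 ^ (d * k) * u ^ (d * k)) := by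
          gcongr
      _ = _ := by
          have h16 : (4 : ℝ) ^ k * 4 ^ k = 16 ^ k := by rw [← mul_pow]; norm_num
          generalize Real.exp 1 = e
          rw [pow_mul 3, pow_mul u, h16]
          simp only [mul_pow]
          ring
  have h2 : T ^ 2 ≤ Real.exp 1 * B * 16 * 3 ^ d * (C.card * k) * u ^ d :=
    (pow_le_pow_iff_left₀ (sq_nonneg _) (by positivity) hk0).mp h1
  refine h2.trans ?_
  have hu' : u ≤ max 1 (2 * ξ * d * (2 * y) / ℓ) := by
    refine max_le_max le_rfl ?_
    push_cast
    rw [← mul_assoc]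
    gcongr
  calc _ = C.card * (Real.exp 1 * B * 16 * 3 ^ d * k * u ^ d) := by ring
    _ ≤ C.card * (Real.exp 1 * B * 16 * 3 ^ d * (2 * y) *
        max 1 (2 * ξ * d * (2 * y) / ℓ) ^ d) := by gcongr

theorem le_max_of_sq_le {T N b a L ℓ : ℝ} (d : ℕ) (hN : 0 < N) (hb : 0 ≤ b) (ha : 0 ≤ a)
    (hL : 0 ≤ L) (hℓ : 0 < ℓ) (hT : T ^ 2 ≤ N * (b * L * max 1 (a * L / ℓ) ^ d)) :
    N⁻¹ * T ≤ N ^ (-(1 / 2) : ℝ) *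
      max (√(b * a ^ d) * ℓ ^ (-((d : ℝ) / 2)) * L ^ (((d : ℝ) + 1) / 2)) (√b * √L) := by
  have e1 : √(b * a ^ d) * ℓ ^ (-((d : ℝ) / 2)) * L ^ (((d : ℝ) + 1) / 2) =
      √(b * L * (a * L / ℓ) ^ d) := by
    have h1 : b * L * (a * L / ℓ) ^ d = b * a ^ d * (ℓ ^ d)⁻¹ * L ^ (d + 1) := by
      rw [div_pow, mul_pow, pow_succ L]; field_simp
    have h2 : ℓ ^ (-((d : ℝ) / 2)) = √((ℓ ^ d)⁻¹) := by
      rw [Real.sqrt_eq_rpow, ← Real.rpow_natCast, ← Real.rpow_neg hℓ.le, ← Real.rpow_mul hℓ.le]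
      congr 1; ring
    have h3 : L ^ (((d : ℝ) + 1) / 2) = √(L ^ (d + 1)) := by
      rw [Real.sqrt_eq_rpow, ← Real.rpow_natCast, ← Real.rpow_mul hL]
      congr 1; push_cast; ring
    rw [h1, h2, h3, Real.sqrt_mul (x := b * a ^ d * (ℓ ^ d)⁻¹) (by positivity),
      Real.sqrt_mul (x := b * a ^ d) (by positivity)]
  have e2 : √b * √L = √(b * L) := (Real.sqrt_mul hb L).symm
  set X := max (√(b * a ^ d) * ℓ ^ (-((d : ℝ) / 2)) * L ^ (((d : ℝ) + 1) / 2)) (√b * √L) with hX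
  have hX0 : 0 ≤ X := le_trans (by positivity) (le_max_right _ _)
  have key : b * L * max 1 (a * L / ℓ) ^ d ≤ X ^ 2 := by
    rcases max_choice 1 (a * L / ℓ) with hm | hm <;> rw [hm]
    · rw [one_pow, mul_one]
      calc b * L = √(b * L) ^ 2 := (Real.sq_sqrt (by positivity)).symm
        _ ≤ X ^ 2 := by
          refine pow_le_pow_left₀ (Real.sqrt_nonneg _) ?_ 2
          rw [← e2]
          exact le_max_right _ _
    · calc b * L * (a * L / ℓ) ^ d = √(b * L * (a * L / ℓ) ^ d) ^ 2 :=
            (Real.sq_sqrt (by positivity)).symm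
        _ ≤ X ^ 2 := by
          refine pow_le_pow_left₀ (Real.sqrt_nonneg _) ?_ 2
          rw [← e1]
          exact le_max_left _ _
  have hT' : T ≤ √N * X := by
    refine (le_abs_self T).trans (abs_le_of_sq_le_sq ?_ (by positivity))
    rw [mul_pow, Real.sq_sqrt hN.le]
    exact hT.trans (mul_le_mul_of_nonneg_left key hN.le)
  have e3 : N ^ (-(1 / 2) : ℝ) = N⁻¹ * √N := by
    have : 0 < √N := Real.sqrt_pos.mpr hN
    rw [Real.rpow_neg hN.le, ← Real.sqrt_eq_rpow]
    nth_rewrite 2 [← Real.mul_self_sqrt hN.le]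
    field_simp
  rw [e3, mul_assoc]
  exact mul_le_mul_of_nonneg_left hT' (by positivity)

/-- The bound of the average distance of the two ensembles on the blocks. -/
theorem exists_avgBlockDist_le (d : ℕ) (hd : 1 ≤ d) (r : ℝ) {ξ κ : ℝ} (hξ : 0 < ξ) (ℓ₀ : ℕ)
    (hκ : 0 < κ) :
    ∃ c₁ > (0 : ℝ), ∃ c₂ > (0 : ℝ),
      ∀ (S : LocalSystem d ℓ₀) (β E Δ : ℝ) (ℓ : ℕ) (C : Finset (Fin d → ℤ)),
        S.Admissible r ξ κ β E Δ ℓ C →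
        S.avgBlockDist β E Δ ℓ C ≤
          (C.card : ℝ) ^ (-(1 / 2) : ℝ) *
            max (c₁ * (ℓ : ℝ) ^ (-((d : ℝ) / 2)) *
                  Real.log (√(S.n : ℝ) / Δ) ^ (((d : ℝ) + 1) / 2))
              (c₂ * √(Real.log (√(S.n : ℝ) / Δ))) := by
  obtain ⟨c, hc, hcZ⟩ := exists_partitionFn_le d ℓ₀ r hξ hκ
  -- Then `y = gL` dominates both `cL`, which bounds the ratio of the ensembles, and `κL ≥ 1`, which
  -- the choice of a power of two requires.
  set g := c + κ with hg
  have hg0 : 0 < g := by positivity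
  have hb := blockConst_pos d r hξ
  have hd0 : (0 : ℝ) < d := by exact_mod_cast hd
  refine ⟨√(blockConst d r ξ * (2 * g) * (2 * ξ * d * (2 * g)) ^ d),
    Real.sqrt_pos.mpr (by positivity), √(blockConst d r ξ * (2 * g)),
    Real.sqrt_pos.mpr (by positivity), ?_⟩
  intro S β E Δ ℓ C h
  have hL := h.log_pos hκ
  set L := Real.log (√(S.n : ℝ) / Δ) with hLdef
  have hκL : 1 ≤ κ * L := h.one_le_mul_log
  have hcL : 0 < c * L := by positivity
  have hQ : 0 ≤ Real.exp (-β * E) * shellCount S.isHermitian_ham E Δ := by positivity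
  have hsq := h.sq_sum_traceNorm_le hξ (y := g * L) (by rw [hg]; linarith)
    ((hcZ S β E Δ ℓ C h).trans (mul_le_mul_of_nonneg_right
      (Real.exp_le_exp.mpr (by rw [hg]; linarith)) hQ))
  refine le_max_of_sq_le d h.card_pos (by positivity) (by positivity) hL.le
    (by exact_mod_cast h.side_pos) (hsq.trans (le_of_eq ?_))
  have e1 : 2 * ξ * d * (2 * (g * L)) = 2 * ξ * d * (2 * g) * L := by ring
  rw [e1]
  ring

theorem log_sqrt_div_le {n Δ a p : ℝ} (hn : 2 ≤ n) (ha : 0 < a) (hΔ : 0 < Δ)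
    (haΔ : a * n ^ (-p) ≤ Δ) :
    Real.log (√n / Δ) ≤ (1 + |1 / 2 + p| + |Real.log a| / Real.log 2) * Real.log n := by
  have hn0 : 0 < n := by linarith
  have hl2 : 0 < Real.log 2 := Real.log_pos one_lt_two
  have hln : Real.log 2 ≤ Real.log n := Real.log_le_log two_pos hn
  have h1 : Real.log a - p * Real.log n ≤ Real.log Δ := by
    have h := Real.log_le_log (by positivity) haΔ
    rw [Real.log_mul ha.ne' (by positivity), Real.log_rpow hn0] at h
    linarith
  rw [Real.log_div (by positivity) hΔ.ne', Real.log_sqrt hn0.le]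
  have h2 : (1 / 2 + p) * Real.log n ≤ |1 / 2 + p| * Real.log n :=
    mul_le_mul_of_nonneg_right (le_abs_self _) (by linarith)
  have h3 : |Real.log a| ≤ |Real.log a| / Real.log 2 * Real.log n := by
    rw [div_mul_eq_mul_div, le_div_iff₀ hl2]
    exact mul_le_mul_of_nonneg_left hln (abs_nonneg _)
  have h4 := neg_abs_le (Real.log a)
  have h5 : (1 + |1 / 2 + p| + |Real.log a| / Real.log 2) * Real.log n =
    Real.log n + |1 / 2 + p| * Real.log n + |Real.log a| / Real.log 2 * Real.log n := by ring
  linarith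

/-- Blocks of at most `K n^{1-ε}` sites leave at least `n^ε / K` of them. -/
theorem card_rpow_le {n N b K ε : ℝ} (hn : 0 < n) (hN : 0 < N) (hK : 0 < K) (hb : n = N * b)
    (hbK : b ≤ K * n ^ (1 - ε)) : N ^ (-(1 / 2) : ℝ) ≤ √K * n ^ (-(ε / 2)) := by
  have h1 : n ^ ε ≤ N * K := by
    have h2 : n ≤ N * (K * n ^ (1 - ε)) := by
      nth_rewrite 1 [hb]
      exact mul_le_mul_of_nonneg_left hbK hN.le
    have h3 : n ^ ε * n ^ (1 - ε) = n := by
      rw [← Real.rpow_add hn]; simp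
    refine le_of_mul_le_mul_right (a := n ^ (1 - ε)) ?_ (by positivity)
    rw [h3, mul_assoc]
    exact h2
  have h4 : K⁻¹ * n ^ ε ≤ N := by
    rw [inv_mul_le_iff₀ hK, mul_comm]
    exact h1
  calc N ^ (-(1 / 2) : ℝ) ≤ (K⁻¹ * n ^ ε) ^ (-(1 / 2) : ℝ) :=
        Real.rpow_le_rpow_of_nonpos (by positivity) h4 (by norm_num)
    _ = √K * n ^ (-(ε / 2)) := by
        rw [Real.mul_rpow (by positivity) (by positivity), ← Real.rpow_mul hn.le,
          Real.inv_rpow hK.le, Real.rpow_neg hK.le, inv_inv, Real.sqrt_eq_rpow]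
        congr 2
        ring

/-- The decay in `ℓ` is dropped, and the square root of `log n` is raised to the power `(d+1)/2` at
the cost of `(log 2)^{-d/2}`, since `n ≥ 2`. -/
theorem max_le_mul_log {ℓ n L c₁ c₂ c₃ : ℝ} (d : ℕ) (hc₁ : 0 ≤ c₁) (hc₂ : 0 ≤ c₂) (hc₃ : 0 ≤ c₃)
    (hℓ : 1 ≤ ℓ) (hn : 2 ≤ n) (hL : 0 ≤ L) (hLn : L ≤ c₃ * Real.log n) :
    max (c₁ * ℓ ^ (-((d : ℝ) / 2)) * L ^ (((d : ℝ) + 1) / 2)) (c₂ * √L) ≤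
      (c₁ * c₃ ^ (((d : ℝ) + 1) / 2) + c₂ * √c₃ * Real.log 2 ^ (-((d : ℝ) / 2))) *
        Real.log n ^ (((d : ℝ) + 1) / 2) := by
  have hl2 : 0 < Real.log 2 := Real.log_pos one_lt_two
  have hln : Real.log 2 ≤ Real.log n := Real.log_le_log two_pos hn
  have hln0 : 0 < Real.log n := by linarith
  have h1 : c₁ * ℓ ^ (-((d : ℝ) / 2)) * L ^ (((d : ℝ) + 1) / 2) ≤
      c₁ * c₃ ^ (((d : ℝ) + 1) / 2) * Real.log n ^ (((d : ℝ) + 1) / 2) := by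
    have h2 : ℓ ^ (-((d : ℝ) / 2)) ≤ 1 :=
      Real.rpow_le_one_of_one_le_of_nonpos hℓ (neg_nonpos.mpr (by positivity))
    calc _ ≤ c₁ * 1 * (c₃ * Real.log n) ^ (((d : ℝ) + 1) / 2) := by gcongr
      _ = _ := by rw [Real.mul_rpow hc₃ hln0.le]; ring
  have h2 : c₂ * √L ≤ c₂ * √c₃ * Real.log 2 ^ (-((d : ℝ) / 2)) *
      Real.log n ^ (((d : ℝ) + 1) / 2) := by
    have h3 : √(Real.log n) = Real.log n ^ (-((d : ℝ) / 2)) * Real.log n ^ (((d : ℝ) + 1) / 2) := by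
      rw [← Real.rpow_add hln0, Real.sqrt_eq_rpow]
      congr 1; ring
    have h4 : Real.log n ^ (-((d : ℝ) / 2)) ≤ Real.log 2 ^ (-((d : ℝ) / 2)) :=
      Real.rpow_le_rpow_of_nonpos hl2 hln (neg_nonpos.mpr (by positivity))
    calc c₂ * √L ≤ c₂ * √(c₃ * Real.log n) := by gcongr
      _ = c₂ * (√c₃ * (Real.log n ^ (-((d : ℝ) / 2)) * Real.log n ^ (((d : ℝ) + 1) / 2))) := by
          rw [Real.sqrt_mul hc₃, h3]
      _ ≤ c₂ * (√c₃ * (Real.log 2 ^ (-((d : ℝ) / 2)) * Real.log n ^ (((d : ℝ) + 1) / 2))) := by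
          gcongr
      _ = _ := by ring
  rw [add_mul]
  refine max_le (h1.trans (le_add_of_nonneg_right (by positivity)))
    (h2.trans (le_add_of_nonneg_left (by positivity)))

theorem exists_avgBlockDist_le_rpow (d : ℕ) (hd : 1 ≤ d) (r : ℝ) {ξ κ : ℝ} (hξ : 0 < ξ) (ℓ₀ : ℕ)
    (hκ : 0 < κ) {ε K a : ℝ} (hK : 0 < K) (ha : 0 < a) (p : ℝ) :
    ∃ c > (0 : ℝ),
      ∀ (S : LocalSystem d ℓ₀) (β E Δ : ℝ) (ℓ : ℕ) (C : Finset (Fin d → ℤ)),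
        S.Admissible r ξ κ β E Δ ℓ C → 2 ≤ S.n → a * (S.n : ℝ) ^ (-p) ≤ Δ →
        (ℓ : ℝ) ^ d ≤ K * (S.n : ℝ) ^ (1 - ε) →
        S.avgBlockDist β E Δ ℓ C ≤
          c * (S.n : ℝ) ^ (-(ε / 2)) * Real.log (S.n : ℝ) ^ (((d : ℝ) + 1) / 2) := by
  obtain ⟨c₁, hc₁, c₂, hc₂, hmain⟩ := exists_avgBlockDist_le d hd r hξ ℓ₀ hκ
  have hl2 : 0 < Real.log 2 := Real.log_pos one_lt_two
  set c₃ := 1 + |1 / 2 + p| + |Real.log a| / Real.log 2 with hc₃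
  have hc₃0 : 0 < c₃ := by positivity
  refine ⟨√K * (c₁ * c₃ ^ (((d : ℝ) + 1) / 2) + c₂ * √c₃ * Real.log 2 ^ (-((d : ℝ) / 2))),
    by positivity, ?_⟩
  intro S β E Δ ℓ C h hn haΔ hℓK
  have hn2 : (2 : ℝ) ≤ S.n := by exact_mod_cast hn
  have hℓ1 : (1 : ℝ) ≤ ℓ := by exact_mod_cast h.side_pos
  have hN := h.card_pos
  refine (hmain S β E Δ ℓ C h).trans ?_
  have h1 := card_rpow_le (by linarith) hN hK h.card_mul hℓK
  have h2 := max_le_mul_log d hc₁.le hc₂.le hc₃0.le hℓ1 hn2 (h.log_pos hκ).le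
    (log_sqrt_div_le hn2 ha h.width_pos haΔ)
  calc _ ≤ (√K * (S.n : ℝ) ^ (-(ε / 2))) *
        ((c₁ * c₃ ^ (((d : ℝ) + 1) / 2) + c₂ * √c₃ * Real.log 2 ^ (-((d : ℝ) / 2))) *
        Real.log (S.n : ℝ) ^ (((d : ℝ) + 1) / 2)) :=
        mul_le_mul h1 h2 (le_trans (by positivity) (le_max_right _ _)) (by positivity)
    _ = _ := by ring

theorem exists_rpow_mul_log_le {c ε q δ : ℝ} (hc : 0 < c) (hε : 0 < ε) (hδ : 0 < δ) :
    ∃ N : ℕ, ∀ n : ℕ, N ≤ n → c * (n : ℝ) ^ (-(ε / 2)) * Real.log (n : ℝ) ^ q ≤ δ := by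
  have h := (isLittleO_log_rpow_rpow_atTop q (half_pos hε)).comp_tendsto
    (tendsto_natCast_atTop_atTop (R := ℝ))
  have h1 := (h.def (div_pos hδ hc)).and (Filter.eventually_ge_atTop 1)
  obtain ⟨N, hN⟩ := Filter.eventually_atTop.mp h1
  refine ⟨N, fun n hn => ?_⟩
  obtain ⟨h2, h3⟩ := hN n hn
  have hn0 : (0 : ℝ) < n := by exact_mod_cast h3
  simp only [Function.comp_apply] at h2
  have h4 : Real.log (n : ℝ) ^ q ≤ δ / c * (n : ℝ) ^ (ε / 2) := by
    refine (Real.le_norm_self _).trans (h2.trans (le_of_eq ?_))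
    rw [Real.norm_of_nonneg (by positivity)]
  calc _ ≤ c * (n : ℝ) ^ (-(ε / 2)) * (δ / c * (n : ℝ) ^ (ε / 2)) := by gcongr
    _ = δ * ((n : ℝ) ^ (-(ε / 2)) * (n : ℝ) ^ (ε / 2)) := by field_simp
    _ = δ := by rw [← Real.rpow_add hn0]; simp

end FinalBounds

end SpinLattice

end

theorem mainTheorem5 (d : ℕ) (hd : 1 ≤ d) (r ξ : ℝ) (hξ : 0 < ξ) (ℓ₀ : ℕ) (κ : ℝ) (hκ : 0 < κ) :
    -- the bound, with constants depending on `d, r, ξ, ℓ₀` and `κ` only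
    (∃ c₁ > (0 : ℝ), ∃ c₂ > (0 : ℝ),
      ∀ (S : SpinLattice.LocalSystem d ℓ₀) (β E Δ : ℝ) (ℓ : ℕ) (C : Finset (Fin d → ℤ)),
        S.Admissible r ξ κ β E Δ ℓ C →
        S.avgBlockDist β E Δ ℓ C ≤
          (C.card : ℝ) ^ (-(1 / 2) : ℝ) *
            max (c₁ * (ℓ : ℝ) ^ (-((d : ℝ) / 2)) *
                  Real.log (√(S.n : ℝ) / Δ) ^ (((d : ℝ) + 1) / 2))
              (c₂ * √(Real.log (√(S.n : ℝ) / Δ)))) ∧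
    -- for `Δ ≥ a n^{-p}` the ensembles agree on all blocks with `ℓ^d ≤ K n^{1-ε}`
    (∀ ε > (0 : ℝ), ∀ K > (0 : ℝ), ∀ a > (0 : ℝ), ∀ p : ℝ,
      (∃ c > (0 : ℝ),
        ∀ (S : SpinLattice.LocalSystem d ℓ₀) (β E Δ : ℝ) (ℓ : ℕ) (C : Finset (Fin d → ℤ)),
          S.Admissible r ξ κ β E Δ ℓ C → 2 ≤ S.n → a * (S.n : ℝ) ^ (-p) ≤ Δ →
          (ℓ : ℝ) ^ d ≤ K * (S.n : ℝ) ^ (1 - ε) →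
          S.avgBlockDist β E Δ ℓ C ≤
            c * (S.n : ℝ) ^ (-(ε / 2)) * Real.log (S.n : ℝ) ^ (((d : ℝ) + 1) / 2)) ∧
      (∀ δ > (0 : ℝ), ∃ N : ℕ,
        ∀ (S : SpinLattice.LocalSystem d ℓ₀) (β E Δ : ℝ) (ℓ : ℕ) (C : Finset (Fin d → ℤ)),
          S.Admissible r ξ κ β E Δ ℓ C → N ≤ S.n → a * (S.n : ℝ) ^ (-p) ≤ Δ →
          (ℓ : ℝ) ^ d ≤ K * (S.n : ℝ) ^ (1 - ε) →
          S.avgBlockDist β E Δ ℓ C ≤ δ)) := by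
  refine ⟨SpinLattice.exists_avgBlockDist_le d hd r hξ ℓ₀ hκ, fun ε hε K hK a ha p => ?_⟩
  obtain ⟨c, hc, h⟩ := SpinLattice.exists_avgBlockDist_le_rpow d hd r hξ ℓ₀ hκ (ε := ε) hK ha p
  refine ⟨⟨c, hc, h⟩, fun δ hδ => ?_⟩
  obtain ⟨N, hN⟩ := SpinLattice.exists_rpow_mul_log_le (q := ((d : ℝ) + 1) / 2) hc hε hδ
  -- The quantitative bound requires `n ≥ 2`.
  refine ⟨max N 2, fun S β E Δ ℓ C hS hn haΔ hℓK => ?_⟩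
  exact (h S β E Δ ℓ C hS ((le_max_right _ _).trans hn) haΔ hℓK).trans
    (hN S.n ((le_max_left _ _).trans hn))
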